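/- All Lie algebras are finite-dimensional over $\mathbb C$. Let $(\mathfrak g_1,\mathfrak g_2)$ be a matched pair of Lie algebras: there are linear maps $\mathfrak g_2\otimes\mathfrak g_1\to\mathfrak g_1$, $\zeta\otimes X\mapsto\zeta\triangleright X$, and $\mathfrak g_2\otimes\mathfrak g_1\to\mathfrak g_2$, $\zeta\otimes X\mapsto\zeta\triangleleft X$, which make $\mathfrak g_1$ a left $\mathfrak g_2$-module and $\mathfrak g_2$ a right $\mathfrak g_1$-module, with $$\zeta\triangleright[X,Y]=[\zeta\triangleright X,Y]+[X,\zeta\triangleright Y]+(\zeta\triangleleft X)\triangleright Y-(\zeta\triangleleft Y)\triangleright X,$$ $$[\zeta,\xi]\triangleleft X=[\zeta\triangleleft X,\xi]+[\zeta,\xi\triangleleft X]+\zeta\triangleleft(\xi\triangleright X)-\xi\triangleleft(\zeta\triangleright X).$$ Let $R(\mathfrak g_2)$ be the Hopf algebra of representative functions on $U(\mathfrak g_2)$, i.e. of the linear functionals on $U(\mathfrak g_2)$ that vanish on some two-sided ideal of finite codimension, with $(fg)(v)=f(v_{(1)})g(v_{(2)})$, unit $\varepsilon$, $\Delta f=\sum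 f'\otimes f''$ where $f(vw)=\sum f'(v)f''(w)$, counit $f\mapsto f(1)$, and $(Sf)(v)=f(Sv)$. Let $v\triangleright X$ be the induced left action of $U(\mathfrak g_2)$ on $\mathfrak g_1$, and let $v\triangleleft u$ be the induced right action of $U(\mathfrak g_1)$ on $U(\mathfrak g_2)$, i.e. the one determined by $1\triangleleft X=0$ and $(v\zeta)\triangleleft X=(v\triangleleft X)\zeta+v\triangleleft(\zeta\triangleright X)+v(\zeta\triangleleft X)$ for $v\in U(\mathfrak g_2)$, $\zeta\in\mathfrak g_2$, $X\in\mathfrak g_1$. Let $X_1,\dots,X_n$ be a basis of $\mathfrak g_1$ with dual basis $\theta^1,\dots,\theta^n$, let $f_i^j(v)=\langle v\triangleright X_i,\theta^j\rangle$ (these belong to $R(\mathfrak g_2)$), and let $\blacktriangledown_{\mathrm{Alg}}:\mathfrak g_1\to\mathfrak g_1\otimes R(\mathfrak g_2)$ be the linear map $X_i\mapsto\sum_j X_j\otimes f_i^j$. Then: 1. The formula $(u\triangleright f)(v)=f(v\triangleleft u)$ defines a left action of the algebra $U(\mathfrak g_1)$ on $R(\mathfrak g_2)$. 2. With this action and with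 $\blacktriangledown_{\mathrm{Alg}}$, written $X\mapsto X_{\langle0\rangle}\otimes X_{\langle1\rangle}$, $R(\mathfrak g_2)$ is a $\mathfrak g_1$-Hopf algebra. That is: $R(\mathfrak g_2)$ is commutative, $\mathfrak g_1$ acts on it by derivations, $\blacktriangledown_{\mathrm{Alg}}$ is a (coassociative and counital) right coaction, the structure identity $$X_i\triangleright f_j^k-X_j\triangleright f_i^k=\sum_{s,r}C_{s,r}^kf_i^rf_j^s+\sum_lC_{i,j}^lf_l^k\qquad\bigl([X_i,X_j]=\sum_kC_{i,j}^kX_k\bigr)$$ holds, and $\Delta(X\triangleright f)=X_{\langle0\rangle}\triangleright f_{(1)}\otimes X_{\langle1\rangle}f_{(2)}+f_{(1)}\otimes X\triangleright f_{(2)}$ and $\varepsilon(X\triangleright f)=0$ for all $X\in\mathfrak g_1$, $f\in R(\mathfrak g_2)$. 3. There is exactly one linear map $\blacktriangledown:U(\mathfrak g_1)\to U(\mathfrak g_1)\otimes R(\mathfrak g_2)$, $u\mapsto u_{\langle0\rangle}\otimes u_{\langle1\rangle}$, that extends $\blacktriangledown_{\mathrm{Alg}}$ and, together with the action in 1, makes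 $(U(\mathfrak g_1),R(\mathfrak g_2))$ a matched pair of Hopf algebras. That is: $\blacktriangledown$ is a right coaction making $U(\mathfrak g_1)$ a right $R(\mathfrak g_2)$-comodule coalgebra, $R(\mathfrak g_2)$ is a left $U(\mathfrak g_1)$-module algebra, and for all $u,v\in U(\mathfrak g_1)$, $f\in R(\mathfrak g_2)$ $$\varepsilon(u\triangleright f)=\varepsilon(u)\varepsilon(f),\qquad \Delta(u\triangleright f)=u_{(1)\langle0\rangle}\triangleright f_{(1)}\otimes u_{(1)\langle1\rangle}(u_{(2)}\triangleright f_{(2)}),\qquad \blacktriangledown(1)=1\otimes1,$$ $$\blacktriangledown(uv)=u_{(1)\langle0\rangle}v_{\langle0\rangle}\otimes u_{(1)\langle1\rangle}(u_{(2)}\triangleright v_{\langle1\rangle}),\qquad u_{(2)\langle0\rangle}\otimes(u_{(1)}\triangleright f)u_{(2)\langle1\rangle}=u_{(1)\langle0\rangle}\otimes u_{(1)\langle1\rangle}(u_{(2)}\triangleright f).$$ -/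

import Mathlib

open scoped TensorProduct

/-! ### The enveloping algebra as a Hopf algebra -/

namespace UniversalEnvelopingAlgebra

section Hopf

attribute [local instance 100] LieRing.ofAssociativeRing LieAlgebra.ofAssociativeAlgebra

variable {K : Type*} [Field K] {L : Type*} [LieRing L] [LieAlgebra K L]

theorem algHom_ext {A : Type*} [Ring A] [Algebra K A]
    {f g : UniversalEnvelopingAlgebra K L →ₐ[K] A} (h : ∀ x : L, f (ι K x) = g (ι K x)) :
    f = g :=
  hom_ext K (LieHom.ext h)

/-- Induction from the right: `U(L)` is spanned by products of elements of `L`. -/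
theorem induction_right {P : UniversalEnvelopingAlgebra K L → Prop}
    (one : P 1) (add : ∀ u v, P u → P v → P (u + v)) (smul : ∀ (c : K) u, P u → P (c • u))
    (mul : ∀ u (x : L), P u → P (u * ι K x)) (u : UniversalEnvelopingAlgebra K L) : P u := by
  have zero : P 0 := by simpa using smul 0 1 one
  let S : Submodule K (UniversalEnvelopingAlgebra K L) :=
    { carrier := {v | ∀ u, P u → P (u * v)}
      add_mem' := fun {a b} ha hb u hu => by
        rw [mul_add]; exact add _ _ (ha u hu) (hb u hu)
      zero_mem' := fun u _ => by rw [mul_zero]; exact zero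
      smul_mem' := fun c a ha u hu => by
        rw [mul_smul_comm]; exact smul _ _ (ha u hu) }
  let T : Subalgebra K (UniversalEnvelopingAlgebra K L) :=
    S.toSubalgebra (fun u hu => by rwa [mul_one])
      (fun a b ha hb u hu => by rw [← mul_assoc]; exact hb _ (ha u hu))
  let j : L →ₗ⁅K⁆ T :=
    { toFun := fun x => ⟨ι K x, fun u hu => mul u x hu⟩
      map_add' := fun x y => Subtype.ext (map_add (ι K) x y)
      map_smul' := fun c x => Subtype.ext (map_smul (ι K) c x)
      map_lie' := fun {x y} => Subtype.ext (LieHom.map_lie (ι K) x y) }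
  have h : T.val.comp (lift K j) = AlgHom.id K _ := by
    refine algHom_ext fun x => ?_
    change T.val (lift K j (ι K x)) = ι K x
    rw [lift_ι_apply]
    rfl
  have h2 : u ∈ T := by
    have := DFunLike.congr_fun h u
    change ((lift K j u : T) : UniversalEnvelopingAlgebra K L) = u at this
    rw [← this]
    exact (lift K j u).2
  simpa using h2 1 one

/-- The comultiplication of `U(L)`, for which the elements of `L` are primitive. -/
noncomputable def comulHom : UniversalEnvelopingAlgebra K L →ₐ[K]
    UniversalEnvelopingAlgebra K L ⊗[K] UniversalEnvelopingAlgebra K L :=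
  lift K
    { toFun := fun x => ι K x ⊗ₜ 1 + 1 ⊗ₜ ι K x
      map_add' := fun x y => by
        rw [map_add, TensorProduct.add_tmul, TensorProduct.tmul_add]; abel
      map_smul' := fun c x => by
        simp only [map_smul, RingHom.id_apply, smul_add, TensorProduct.smul_tmul',
          TensorProduct.tmul_smul]
      map_lie' := fun {x y} => by
        simp only [LieHom.map_lie, LieRing.of_associative_ring_bracket, mul_add, add_mul,
          Algebra.TensorProduct.tmul_mul_tmul, one_mul, mul_one, TensorProduct.sub_tmul,
          TensorProduct.tmul_sub]
        abel }

/-- The counit of `U(L)`. -/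
noncomputable def counitHom : UniversalEnvelopingAlgebra K L →ₐ[K] K := lift K 0

/-- The antipode of `U(L)`, as an algebra map to the opposite algebra. -/
noncomputable def antipodeHom :
    UniversalEnvelopingAlgebra K L →ₐ[K] (UniversalEnvelopingAlgebra K L)ᵐᵒᵖ :=
  lift K
    { toFun := fun x => MulOpposite.op (-ι K x)
      map_add' := fun x y => by
        rw [map_add, neg_add, MulOpposite.op_add]
      map_smul' := fun c x => by
        rw [map_smul, RingHom.id_apply, ← smul_neg, MulOpposite.op_smul]
      map_lie' := fun {x y} => by
        simp only [LieHom.map_lie, LieRing.of_associative_ring_bracket, ← MulOpposite.op_mul,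
          ← MulOpposite.op_sub, neg_mul_neg, neg_sub] }

theorem comulHom_ι (x : L) : comulHom (ι K x) = ι K x ⊗ₜ[K] 1 + 1 ⊗ₜ[K] ι K x :=
  lift_ι_apply K _ x

theorem counitHom_ι (x : L) : counitHom (ι K x) = (0 : K) :=
  lift_ι_apply K _ x

theorem antipodeHom_ι (x : L) : antipodeHom (ι K x) = MulOpposite.op (-ι K x) :=
  lift_ι_apply K _ x

noncomputable instance : Bialgebra K (UniversalEnvelopingAlgebra K L) :=
  Bialgebra.ofAlgHom comulHom counitHom
    (by
      refine algHom_ext fun x => ?_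
      change (Algebra.TensorProduct.assoc K K K (UniversalEnvelopingAlgebra K L)
        (UniversalEnvelopingAlgebra K L) (UniversalEnvelopingAlgebra K L))
        (Algebra.TensorProduct.map comulHom (.id K (UniversalEnvelopingAlgebra K L))
          (comulHom (ι K x))) =
        Algebra.TensorProduct.map (.id K (UniversalEnvelopingAlgebra K L)) comulHom
          (comulHom (ι K x))
      simp only [comulHom_ι, map_add, Algebra.TensorProduct.map_tmul, map_one,
        AlgHom.coe_id, id_eq, TensorProduct.add_tmul, TensorProduct.tmul_add,
        Algebra.TensorProduct.assoc_tmul, Algebra.TensorProduct.one_def]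
      abel)
    (by
      refine algHom_ext fun x => ?_
      change Algebra.TensorProduct.map counitHom (.id K (UniversalEnvelopingAlgebra K L)) (comulHom (ι K x)) =
        (Algebra.TensorProduct.lid K _).symm (ι K x)
      simp [comulHom_ι, counitHom_ι, -ι_apply])
    (by
      refine algHom_ext fun x => ?_
      change Algebra.TensorProduct.map (.id K (UniversalEnvelopingAlgebra K L)) counitHom (comulHom (ι K x)) =
        (Algebra.TensorProduct.rid K K _).symm (ι K x)
      simp [comulHom_ι, counitHom_ι, -ι_apply])

theorem comul_ι (x : L) :
    Coalgebra.comul (R := K) (ι K x) = ι K x ⊗ₜ[K] 1 + 1 ⊗ₜ[K] ι K x :=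
  comulHom_ι x

theorem counit_ι (x : L) : Coalgebra.counit (R := K) (ι K x) = 0 := counitHom_ι x

/-- The antipode of `U(L)`: the anti-automorphism that is `-1` on `L`. -/
noncomputable def antipodeLin :
    UniversalEnvelopingAlgebra K L →ₗ[K] UniversalEnvelopingAlgebra K L :=
  (MulOpposite.opLinearEquiv K).symm.toLinearMap ∘ₗ antipodeHom.toLinearMap

theorem antipodeLin_one : antipodeLin (1 : UniversalEnvelopingAlgebra K L) = 1 := by
  simp [antipodeLin]

theorem antipodeLin_mul_ι (u : UniversalEnvelopingAlgebra K L) (x : L) :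
    antipodeLin (u * ι K x) = -(ι K x) * antipodeLin u := by
  simp [antipodeLin, antipodeHom_ι, -ι_apply]

noncomputable instance : HopfAlgebra K (UniversalEnvelopingAlgebra K L) where
  antipode := antipodeLin
  mul_antipode_rTensor_comul := by
    ext u
    change LinearMap.mul' K _ (antipodeLin.rTensor _ (Coalgebra.comul u)) =
      algebraMap K _ (Coalgebra.counit u)
    induction u using induction_right with
    | one => simp [Algebra.TensorProduct.one_def, antipodeLin_one]
    | add u v hu hv => simp only [map_add, hu, hv]
    | smul c u hu => simp only [map_smul, hu]; simp [Algebra.smul_def]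
    | mul u x hu =>
      have key : ∀ t : UniversalEnvelopingAlgebra K L ⊗[K] UniversalEnvelopingAlgebra K L,
          LinearMap.mul' K _ (antipodeLin.rTensor _ (t * (ι K x ⊗ₜ 1 + 1 ⊗ₜ ι K x))) =
          LinearMap.mul' K _ (antipodeLin.rTensor _ t) * ι K x
            - ι K x * LinearMap.mul' K _ (antipodeLin.rTensor _ t) := by
        intro t
        induction t with
        | zero => simp
        | add s t hs ht => rw [add_mul, map_add, map_add, hs, ht, map_add, map_add]; noncomm_ring
        | tmul a b =>
          simp only [mul_add, Algebra.TensorProduct.tmul_mul_tmul, mul_one, map_add,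
            LinearMap.rTensor_tmul, LinearMap.mul'_apply, antipodeLin_mul_ι]
          noncomm_ring
      rw [Bialgebra.comul_mul, comul_ι, key, hu, Bialgebra.counit_mul, counit_ι,
        Algebra.commutes, sub_self, mul_zero, map_zero]
  mul_antipode_lTensor_comul := by
    ext u
    change LinearMap.mul' K _ (antipodeLin.lTensor _ (Coalgebra.comul u)) =
      algebraMap K _ (Coalgebra.counit u)
    induction u using induction_right with
    | one => simp [Algebra.TensorProduct.one_def, antipodeLin_one]
    | add u v hu hv => simp only [map_add, hu, hv]
    | smul c u hu => simp only [map_smul, hu]; simp [Algebra.smul_def]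
    | mul u x hu =>
      have key : ∀ t : UniversalEnvelopingAlgebra K L ⊗[K] UniversalEnvelopingAlgebra K L,
          LinearMap.mul' K _ (antipodeLin.lTensor _ (t * (ι K x ⊗ₜ 1 + 1 ⊗ₜ ι K x))) = 0 := by
        intro t
        induction t with
        | zero => simp
        | add s t hs ht => rw [add_mul, map_add, map_add, hs, ht, add_zero]
        | tmul a b =>
          simp only [mul_add, Algebra.TensorProduct.tmul_mul_tmul, mul_one, map_add,
            LinearMap.lTensor_tmul, LinearMap.mul'_apply, antipodeLin_mul_ι]
          noncomm_ring
      rw [Bialgebra.comul_mul, comul_ι, key, Bialgebra.counit_mul, counit_ι, mul_zero, map_zero]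

end Hopf

end UniversalEnvelopingAlgebra

/-! ### Representative functions -/

namespace FiniteDual

open Coalgebra LinearMap WithConv

section Slice

variable {K : Type*} [Field K] {V W A : Type*} [AddCommGroup V] [Module K V]
  [AddCommGroup W] [Module K W]

/-- If functionals `p a` separate the points of `V`, then the maps `p a ⊗ id` separate the points
of `V ⊗ W`. -/
theorem eq_of_slices (p : A → V →ₗ[K] K) (hp : ∀ v, (∀ a, p a v = 0) → v = 0)
    {s t : V ⊗[K] W}
    (h : ∀ a, TensorProduct.lid K W ((p a).rTensor W s) =
      TensorProduct.lid K W ((p a).rTensor W t)) : s = t := by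
  classical
  let c := Module.Basis.ofVectorSpace K W
  have key : ∀ (a : A) (r : V ⊗[K] W) (k),
      c.repr (TensorProduct.lid K W ((p a).rTensor W r)) k =
        p a (TensorProduct.equivFinsuppOfBasisRight c r k) := by
    intro a r k
    induction r with
    | zero => simp
    | add x y hx hy => simp only [map_add, Finsupp.add_apply, hx, hy]
    | tmul v w =>
      simp [mul_comm]
  apply (TensorProduct.equivFinsuppOfBasisRight c).injective
  ext k
  rw [← sub_eq_zero]
  apply hp
  intro a
  rw [map_sub, ← key, ← key, h a, sub_self]

end Slice

variable (K : Type*) [Field K] (A : Type*) [Ring A] [HopfAlgebra K A]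

/-- A linear functional is representative if it vanishes on a two-sided ideal of finite
codimension. -/
def IsRepresentative {K : Type*} [Field K] {A : Type*} [Ring A] [HopfAlgebra K A]
    (f : A →ₗ[K] K) : Prop :=
  ∃ I : Ideal A, I.IsTwoSided ∧ FiniteDimensional K (A ⧸ I) ∧ ∀ x ∈ I, f x = 0

variable {K A}

theorem isRepresentative_comp {B : Type*} [Ring B] [Algebra K B] [FiniteDimensional K B]
    (π : A →ₐ[K] B) (g : B →ₗ[K] K) : IsRepresentative (g ∘ₗ π.toLinearMap) := by
  refine ⟨RingHom.ker π, inferInstance, ?_, fun x hx => ?_⟩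
  · exact FiniteDimensional.of_injective (Ideal.kerLiftAlg π).toLinearMap
      (Ideal.kerLiftAlg_injective π)
  · have : π x = 0 := hx
    simp [this]

theorem IsRepresentative.exists_comp {f : A →ₗ[K] K} (hf : IsRepresentative f) :
    ∃ (I : Ideal A) (_ : I.IsTwoSided) (_ : FiniteDimensional K (A ⧸ I))
      (g : (A ⧸ I) →ₗ[K] K), f = g ∘ₗ (Ideal.Quotient.mkₐ K I).toLinearMap := by
  obtain ⟨I, h1, h2, h3⟩ := hf
  refine ⟨I, h1, h2,
    { toFun := Quotient.lift (s := Submodule.quotientRel I) f ?_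
      map_add' := ?_, map_smul' := ?_ }, ?_⟩
  · intro a b hab
    have : a - b ∈ I := (Submodule.quotientRel_def I).1 hab
    rw [← sub_eq_zero, ← map_sub]
    exact h3 _ this
  · rintro ⟨a⟩ ⟨b⟩
    exact map_add f a b
  · rintro c ⟨a⟩
    exact map_smul f c a
  · rfl

variable (K A) in
/-- The algebra of representative functions on `A`, under the convolution product
`(f * g)(a) = f(a₁) g(a₂)` and with unit the counit of `A`. -/
def finiteDualSubalgebra : Subalgebra K (WithConv (A →ₗ[K] K)) where
  carrier := {f | IsRepresentative f.ofConv}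
  mul_mem' := by
    rintro f g hf hg
    obtain ⟨I, _, _, f', hf⟩ := hf.exists_comp
    obtain ⟨J, _, _, g', hg⟩ := hg.exists_comp
    have : (f * g).ofConv = (mul' K K ∘ₗ TensorProduct.map f' g') ∘ₗ
        ((Algebra.TensorProduct.map (Ideal.Quotient.mkₐ K I) (Ideal.Quotient.mkₐ K J)).comp
          (Bialgebra.comulAlgHom K A)).toLinearMap := by
      ext a
      rw [LinearMap.convMul_def, hf, hg, TensorProduct.map_comp]
      rfl
    change IsRepresentative (f * g).ofConv
    rw [this]
    exact isRepresentative_comp _ _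
  add_mem' := by
    rintro f g hf hg
    obtain ⟨I, _, _, f', hf⟩ := hf.exists_comp
    obtain ⟨J, _, _, g', hg⟩ := hg.exists_comp
    have : (f + g).ofConv = (f'.coprod g') ∘ₗ
        ((Ideal.Quotient.mkₐ K I).prod (Ideal.Quotient.mkₐ K J)).toLinearMap := by
      rw [ofConv_add, hf, hg]
      ext a
      simp
    change IsRepresentative (f + g).ofConv
    rw [this]
    exact isRepresentative_comp _ _
  algebraMap_mem' := by
    intro c
    have : (algebraMap K (WithConv (A →ₗ[K] K)) c).ofConv =
        (c • LinearMap.id) ∘ₗ (Bialgebra.counitAlgHom K A).toLinearMap := by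
      ext a
      simp
    change IsRepresentative (algebraMap K (WithConv (A →ₗ[K] K)) c).ofConv
    rw [this]
    exact isRepresentative_comp _ _

variable (K A) in
/-- The Hopf algebra of representative functions on `A`. -/
def _root_.FiniteDual : Type _ := finiteDualSubalgebra K A

noncomputable instance : Ring (FiniteDual K A) :=
  inferInstanceAs (Ring (finiteDualSubalgebra K A))

noncomputable instance : Algebra K (FiniteDual K A) :=
  inferInstanceAs (Algebra K (finiteDualSubalgebra K A))

/-- A representative function as a linear functional. -/
def toLinearMap (f : FiniteDual K A) : A →ₗ[K] K :=
  WithConv.ofConv (Subtype.val (p := fun g => g ∈ finiteDualSubalgebra K A) f)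

theorem isRepresentative (f : FiniteDual K A) : IsRepresentative f.toLinearMap :=
  Subtype.property (p := fun g => g ∈ finiteDualSubalgebra K A) f

/-- A linear functional known to be representative, as an element of the finite dual. -/
def of (f : A →ₗ[K] K) (hf : IsRepresentative f) : FiniteDual K A :=
  (⟨toConv f, hf⟩ : finiteDualSubalgebra K A)

/-- The pairing `⟨f, a⟩ = f(a)`, as a functional of `f`. -/
def ev (a : A) : FiniteDual K A →ₗ[K] K where
  toFun f := f.toLinearMap a
  map_add' _ _ := rfl
  map_smul' _ _ := rfl

theorem ext_ev {f g : FiniteDual K A} (h : ∀ a, ev a f = ev a g) : f = g :=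
  Subtype.ext (WithConv.ext (LinearMap.ext h))

theorem ev_add (a b : A) (f : FiniteDual K A) : ev (a + b) f = ev a f + ev b f :=
  map_add f.toLinearMap a b

theorem ev_smul (c : K) (a : A) (f : FiniteDual K A) : ev (c • a) f = c * ev a f :=
  map_smul f.toLinearMap c a

theorem ev_sum {ι : Type*} (s : Finset ι) (a : ι → A) (f : FiniteDual K A) :
    ev (∑ i ∈ s, a i) f = ∑ i ∈ s, ev (a i) f :=
  map_sum f.toLinearMap a s

theorem ev_one_right (a : A) : ev a (1 : FiniteDual K A) = counit (R := K) a := rfl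

theorem ev_mul {ι : Type*} {a : A} (r : Coalgebra.Repr K a ι) (f g : FiniteDual K A) :
    ev a (f * g) = ∑ i ∈ r.index, ev (r.left i) f * ev (r.right i) g :=
  r.convMul_apply (toConv f.toLinearMap) (toConv g.toLinearMap)

theorem ev_one_mul (f g : FiniteDual K A) : ev 1 (f * g) = ev 1 f * ev 1 g := by
  change mul' K K (TensorProduct.map f.toLinearMap g.toLinearMap (comul 1)) = _
  rw [Bialgebra.comul_one, Algebra.TensorProduct.one_def, TensorProduct.map_tmul, mul'_apply]
  rfl

/-- Evaluation of the first tensor factor at `a`. -/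
noncomputable def slice {W : Type*} [AddCommGroup W] [Module K W] (a : A) :
    FiniteDual K A ⊗[K] W →ₗ[K] W :=
  (TensorProduct.lid K W).toLinearMap ∘ₗ (ev a).rTensor W

theorem slice_tmul {W : Type*} [AddCommGroup W] [Module K W] (a : A) (f : FiniteDual K A)
    (w : W) : slice a (f ⊗ₜ[K] w) = ev a f • w := by
  simp [slice]

theorem ext_slice {W : Type*} [AddCommGroup W] [Module K W] {s t : FiniteDual K A ⊗[K] W}
    (h : ∀ a : A, slice a s = slice a t) : s = t :=
  eq_of_slices (fun a : A => ev a) (fun _ hv => ext_ev (fun a => by rw [hv a, map_zero])) h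

/-- Evaluation of an element of `R ⊗ R` at a pair. -/
theorem ext_slice₂ {s t : FiniteDual K A ⊗[K] FiniteDual K A}
    (h : ∀ a b : A, ev b (slice a s) = ev b (slice a t)) : s = t :=
  ext_slice fun a => ext_ev fun b => h a b

theorem exists_comul (f : FiniteDual K A) :
    ∃ t : FiniteDual K A ⊗[K] FiniteDual K A, ∀ a b : A, ev b (slice a t) = ev (a * b) f := by
  obtain ⟨I, _, _, g, hg⟩ := f.isRepresentative.exists_comp
  let pull : Module.Dual K (A ⧸ I) →ₗ[K] FiniteDual K A :=
    { toFun := fun h => of (h ∘ₗ (Ideal.Quotient.mkₐ K I).toLinearMap)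
        (isRepresentative_comp (Ideal.Quotient.mkₐ K I) h)
      map_add' := fun _ _ => rfl
      map_smul' := fun _ _ => rfl }
  have key : ∀ (s : Module.Dual K (A ⧸ I) ⊗[K] Module.Dual K (A ⧸ I)) (a b : A),
      ev b (slice a (TensorProduct.map pull pull s)) =
        TensorProduct.dualDistrib K _ _ s
          (Ideal.Quotient.mkₐ K I a ⊗ₜ Ideal.Quotient.mkₐ K I b) := by
    intro s a b
    induction s with
    | zero => simp
    | add x y hx hy => simp only [map_add, LinearMap.add_apply, hx, hy]
    | tmul x y =>
      rw [TensorProduct.map_tmul, slice_tmul, map_smul, TensorProduct.dualDistrib_apply]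
      rfl
  refine ⟨TensorProduct.map pull pull
    ((TensorProduct.dualDistribEquiv K (A ⧸ I) (A ⧸ I)).symm (g ∘ₗ mul' K (A ⧸ I))),
    fun a b => ?_⟩
  rw [key]
  have h2 : TensorProduct.dualDistrib K (A ⧸ I) (A ⧸ I)
      ((TensorProduct.dualDistribEquiv K (A ⧸ I) (A ⧸ I)).symm (g ∘ₗ mul' K (A ⧸ I))) =
      g ∘ₗ mul' K (A ⧸ I) :=
    (TensorProduct.dualDistribEquiv K (A ⧸ I) (A ⧸ I)).apply_symm_apply _
  rw [h2]
  change _ = f.toLinearMap (a * b)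
  rw [hg]
  simp

/-- The comultiplication of representative functions: `Δ f = ∑ f' ⊗ f''` where
`f(ab) = ∑ f'(a) f''(b)`. -/
noncomputable def comulMap : FiniteDual K A →ₗ[K] FiniteDual K A ⊗[K] FiniteDual K A where
  toFun f := (exists_comul f).choose
  map_add' f g := ext_slice₂ fun a b => by
    rw [(exists_comul (f + g)).choose_spec a b]
    simp only [map_add, (exists_comul f).choose_spec a b, (exists_comul g).choose_spec a b]
  map_smul' c f := ext_slice₂ fun a b => by
    rw [(exists_comul (c • f)).choose_spec a b]
    simp only [map_smul, RingHom.id_apply, (exists_comul f).choose_spec a b]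

theorem ev_comulMap (f : FiniteDual K A) (a b : A) :
    ev b (slice a (comulMap f)) = ev (a * b) f :=
  (exists_comul f).choose_spec a b

noncomputable instance : Coalgebra K (FiniteDual K A) where
  comul := comulMap
  counit := ev 1
  coassoc := by
    ext f : 1
    change TensorProduct.assoc K _ _ _ (comulMap.rTensor _ (comulMap f)) =
      comulMap.lTensor _ (comulMap f)
    refine ext_slice fun a => ext_slice fun b => ext_ev fun c => ?_
    have h1 : ∀ t : FiniteDual K A ⊗[K] FiniteDual K A,
        slice b (slice a (TensorProduct.assoc K _ _ _ (comulMap.rTensor _ t))) =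
          slice (a * b) t := by
      intro t
      induction t with
      | zero => simp
      | add x y hx hy => simp only [map_add, hx, hy]
      | tmul x y =>
        rw [rTensor_tmul, slice_tmul, ← ev_comulMap]
        generalize comulMap x = s
        induction s with
        | zero => simp
        | add p q hp hq => simp only [TensorProduct.add_tmul, map_add, hp, hq, add_smul]
        | tmul p q =>
          simp only [TensorProduct.assoc_tmul, slice_tmul, map_smul, smul_smul, smul_eq_mul]
    have h2 : ∀ t : FiniteDual K A ⊗[K] FiniteDual K A,
        slice a (comulMap.lTensor _ t) = comulMap (slice a t) := by
      intro t
      induction t with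
      | zero => simp
      | add x y hx hy => simp only [map_add, hx, hy]
      | tmul x y => simp only [lTensor_tmul, slice_tmul, map_smul]
    rw [h1, h2, ev_comulMap, ev_comulMap, ev_comulMap, mul_assoc]
  rTensor_counit_comp_comul := by
    ext f : 1
    change (ev 1).rTensor _ (comulMap f) = 1 ⊗ₜ f
    apply (TensorProduct.lid K _).injective
    refine ext_ev fun b => ?_
    have := ev_comulMap f 1 b
    rw [one_mul] at this
    simpa [slice] using this
  lTensor_counit_comp_comul := by
    ext f : 1
    change (ev 1).lTensor _ (comulMap f) = f ⊗ₜ 1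
    refine ext_slice fun a => ?_
    have h : ∀ t : FiniteDual K A ⊗[K] FiniteDual K A,
        slice a ((ev 1).lTensor _ t) = ev 1 (slice a t) := by
      intro t
      induction t with
      | zero => simp
      | add x y hx hy => simp only [map_add, hx, hy]
      | tmul x y => simp only [lTensor_tmul, slice_tmul, map_smul]
    rw [h, ev_comulMap, mul_one, slice_tmul, smul_eq_mul, mul_one]

theorem ev_comul (f : FiniteDual K A) (a b : A) :
    ev b (slice a (comul (R := K) f)) = ev (a * b) f :=
  ev_comulMap f a b

theorem counit_eq (f : FiniteDual K A) : counit (R := K) f = ev 1 f := rfl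

theorem ev_slice_mul {ι κ : Type*} {a b : A} (r : Coalgebra.Repr K a ι)
    (q : Coalgebra.Repr K b κ) (s t : FiniteDual K A ⊗[K] FiniteDual K A) :
    ev b (slice a (s * t)) = ∑ i ∈ r.index, ∑ j ∈ q.index,
      ev (q.left j) (slice (r.left i) s) * ev (q.right j) (slice (r.right i) t) := by
  induction s with
  | zero => simp
  | add x y hx hy => simp only [add_mul, map_add, hx, hy, Finset.sum_add_distrib]
  | tmul f g =>
    induction t with
    | zero => simp
    | add x y hx hy => simp only [mul_add, map_add, hx, hy, Finset.sum_add_distrib]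
    | tmul f' g' =>
      simp only [Algebra.TensorProduct.tmul_mul_tmul, slice_tmul, map_smul, smul_eq_mul,
        ev_mul r, ev_mul q, Finset.sum_mul_sum]
      refine Finset.sum_congr rfl fun i _ => Finset.sum_congr rfl fun j _ => ?_
      ring

noncomputable instance : Bialgebra K (FiniteDual K A) :=
  Bialgebra.mk' K (FiniteDual K A)
    (by rw [counit_eq, ev_one_right, Bialgebra.counit_one])
    (by intro f g; exact ev_one_mul f g)
    (by
      refine ext_slice₂ fun a b => ?_
      rw [ev_comul, Algebra.TensorProduct.one_def, slice_tmul, map_smul, ev_one_right,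
        ev_one_right, ev_one_right, Bialgebra.counit_mul, smul_eq_mul])
    (by
      intro f g
      refine ext_slice₂ fun a b => ?_
      rw [ev_comul, ev_slice_mul (ℛ K a) (ℛ K b)]
      simp only [ev_comul]
      rw [ev_mul ((ℛ K a).mul (ℛ K b))]
      simp [Finset.sum_product])

theorem isRepresentative_antipode (f : FiniteDual K A) :
    IsRepresentative (f.toLinearMap ∘ₗ HopfAlgebra.antipode K (A := A)) := by
  obtain ⟨I, _, _, g, hg⟩ := f.isRepresentative.exists_comp
  let π : A →ₐ[K] (A ⧸ I)ᵐᵒᵖ := AlgHom.ofLinearMap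
    ((MulOpposite.opLinearEquiv K).toLinearMap ∘ₗ (Ideal.Quotient.mkₐ K I).toLinearMap ∘ₗ
      HopfAlgebra.antipode K (A := A))
    (by simp)
    (by intro x y; simp [HopfAlgebra.antipode_mul_antidistrib])
  have : f.toLinearMap ∘ₗ HopfAlgebra.antipode K (A := A) =
      (g ∘ₗ (MulOpposite.opLinearEquiv K).symm.toLinearMap) ∘ₗ π.toLinearMap := by
    rw [hg]; rfl
  rw [this]
  exact isRepresentative_comp _ _

/-- The antipode of representative functions, `(S f)(a) = f(S a)`. -/
noncomputable def antipodeMap : FiniteDual K A →ₗ[K] FiniteDual K A where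
  toFun f := of (f.toLinearMap ∘ₗ HopfAlgebra.antipode K (A := A))
    (isRepresentative_antipode f)
  map_add' _ _ := rfl
  map_smul' _ _ := rfl

theorem ev_antipodeMap (a : A) (f : FiniteDual K A) :
    ev a (antipodeMap f) = ev (HopfAlgebra.antipode K a) f := rfl

noncomputable instance : HopfAlgebra K (FiniteDual K A) where
  antipode := antipodeMap
  mul_antipode_rTensor_comul := by
    ext f : 1
    refine ext_ev fun a => ?_
    change ev a (mul' K _ (antipodeMap.rTensor _ (comul f))) =
      ev a (algebraMap K _ (counit (R := K) f))
    have h : ∀ t : FiniteDual K A ⊗[K] FiniteDual K A,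
        ev a (mul' K _ (antipodeMap.rTensor _ t)) = ∑ i ∈ (ℛ K a).index,
          ev ((ℛ K a).right i) (slice (HopfAlgebra.antipode K ((ℛ K a).left i)) t) := by
      intro t
      induction t with
      | zero => simp
      | add x y hx hy => simp only [map_add, hx, hy, Finset.sum_add_distrib]
      | tmul x y =>
        simp only [rTensor_tmul, mul'_apply, ev_mul (ℛ K a), ev_antipodeMap, slice_tmul,
          map_smul, smul_eq_mul]
    rw [h]
    simp only [ev_comul]
    rw [← ev_sum, HopfAlgebra.sum_antipode_mul_eq_smul, ev_smul, counit_eq,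
      Algebra.algebraMap_eq_smul_one, map_smul, ev_one_right, smul_eq_mul, mul_comm]
  mul_antipode_lTensor_comul := by
    ext f : 1
    refine ext_ev fun a => ?_
    change ev a (mul' K _ (antipodeMap.lTensor _ (comul f))) =
      ev a (algebraMap K _ (counit (R := K) f))
    have h : ∀ t : FiniteDual K A ⊗[K] FiniteDual K A,
        ev a (mul' K _ (antipodeMap.lTensor _ t)) = ∑ i ∈ (ℛ K a).index,
          ev (HopfAlgebra.antipode K ((ℛ K a).right i)) (slice ((ℛ K a).left i) t) := by
      intro t
      induction t with
      | zero => simp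
      | add x y hx hy => simp only [map_add, hx, hy, Finset.sum_add_distrib]
      | tmul x y =>
        simp only [lTensor_tmul, mul'_apply, ev_mul (ℛ K a), ev_antipodeMap, slice_tmul,
          map_smul, smul_eq_mul]
    rw [h]
    simp only [ev_comul]
    rw [← ev_sum, HopfAlgebra.sum_mul_antipode_eq_smul, ev_smul, counit_eq,
      Algebra.algebraMap_eq_smul_one, map_smul, ev_one_right, smul_eq_mul, mul_comm]

end FiniteDual

/-- The Hopf algebra `R(g)` of representative functions on `U(g)`. -/
abbrev RepresentativeFunctions (K : Type*) [Field K] (L : Type*) [LieRing L] [LieAlgebra K L] :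
    Type _ :=
  FiniteDual K (UniversalEnvelopingAlgebra K L)

/-! ### Matched pairs of Lie algebras -/

/-- A matched pair of Lie algebras: linear maps `ζ ⊗ X ↦ ζ ▷ X ∈ g₁` (`lact`) and
`ζ ⊗ X ↦ ζ ◁ X ∈ g₂` (`ract`) making `g₁` a left `g₂`-module and `g₂` a right `g₁`-module, with
the two compatibility conditions. -/
structure LieMatchedPair (K : Type*) [Field K] (g₁ g₂ : Type*) [LieRing g₁] [LieAlgebra K g₁]
    [LieRing g₂] [LieAlgebra K g₂] where
  /-- `ζ ▷ X` -/
  lact : g₂ →ₗ[K] g₁ →ₗ[K] g₁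
  /-- `ζ ◁ X` -/
  ract : g₂ →ₗ[K] g₁ →ₗ[K] g₂
  bracket_lact : ∀ ζ ξ X, lact ⁅ζ, ξ⁆ X = lact ζ (lact ξ X) - lact ξ (lact ζ X)
  ract_bracket : ∀ ζ X Y, ract ζ ⁅X, Y⁆ = ract (ract ζ X) Y - ract (ract ζ Y) X
  lact_bracket : ∀ ζ X Y, lact ζ ⁅X, Y⁆ =
    ⁅lact ζ X, Y⁆ + ⁅X, lact ζ Y⁆ + lact (ract ζ X) Y - lact (ract ζ Y) X
  bracket_ract : ∀ ζ ξ X, ract ⁅ζ, ξ⁆ X =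
    ⁅ract ζ X, ξ⁆ + ⁅ζ, ract ξ X⁆ + ract ζ (lact ξ X) - ract ξ (lact ζ X)

namespace LieMatchedPair

open UniversalEnvelopingAlgebra FiniteDual

section Actions

attribute [local instance 100] LieRing.ofAssociativeRing LieAlgebra.ofAssociativeAlgebra

variable {K : Type*} [Field K] {g₁ g₂ : Type*} [LieRing g₁] [LieAlgebra K g₁]
    [LieRing g₂] [LieAlgebra K g₂] (M : LieMatchedPair K g₁ g₂)

/-- The left action `v ▷ X` of `U(g₂)` on `g₁` extending that of `g₂`. -/
noncomputable def lactU : UniversalEnvelopingAlgebra K g₂ →ₐ[K] Module.End K g₁ :=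
  lift K
    { toFun := fun ζ => M.lact ζ
      map_add' := fun ζ ξ => map_add M.lact ζ ξ
      map_smul' := fun c ζ => map_smul M.lact c ζ
      map_lie' := fun {ζ ξ} => LinearMap.ext fun X => M.bracket_lact ζ ξ X }

theorem lactU_ι (ζ : g₂) (X : g₁) : M.lactU (ι K ζ) X = M.lact ζ X := by
  rw [lactU, lift_ι_apply]; rfl

/-- Right multiplication by `ζ` on pairs `(v, D)`, `D` standing for `X ↦ v ◁ X`:
`(v, D) · ζ = (v ζ, X ↦ D(X) ζ + D(ζ ▷ X) + v (ζ ◁ X))`. -/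
noncomputable def ractStep (ζ : g₂) :
    (UniversalEnvelopingAlgebra K g₂ × (g₁ →ₗ[K] UniversalEnvelopingAlgebra K g₂)) →ₗ[K]
    (UniversalEnvelopingAlgebra K g₂ × (g₁ →ₗ[K] UniversalEnvelopingAlgebra K g₂)) where
  toFun p := (p.1 * ι K ζ,
    { toFun := fun X => p.2 X * ι K ζ + p.2 (M.lact ζ X) + p.1 * ι K (M.ract ζ X)
      map_add' := fun X Y => by
        simp only [map_add, add_mul, mul_add]; abel
      map_smul' := fun c X => by
        simp only [map_smul, smul_mul_assoc, mul_smul_comm, smul_add, RingHom.id_apply] })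
  map_add' p q := by
    refine Prod.ext ?_ (LinearMap.ext fun X => ?_)
    · simp only [Prod.fst_add, add_mul]
    · simp only [Prod.fst_add, Prod.snd_add, LinearMap.add_apply, LinearMap.coe_mk,
        AddHom.coe_mk, add_mul]
      abel
  map_smul' c p := by
    refine Prod.ext ?_ (LinearMap.ext fun X => ?_)
    · simp only [Prod.smul_fst, smul_mul_assoc, RingHom.id_apply]
    · simp only [Prod.smul_fst, Prod.smul_snd, LinearMap.smul_apply, LinearMap.coe_mk,
        AddHom.coe_mk, smul_mul_assoc, smul_add, RingHom.id_apply]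

theorem ractStep_fst (ζ : g₂) (p) : (M.ractStep ζ p).1 = p.1 * ι K ζ := rfl

theorem ractStep_snd (ζ : g₂) (p) (X : g₁) : (M.ractStep ζ p).2 X =
    p.2 X * ι K ζ + p.2 (M.lact ζ X) + p.1 * ι K (M.ract ζ X) := rfl

/-- The right `U(g₂)`-module structure on pairs `(v, D)` given by the steps above. -/
noncomputable def ractStepHom : UniversalEnvelopingAlgebra K g₂ →ₐ[K]
    (Module.End K (UniversalEnvelopingAlgebra K g₂ ×
      (g₁ →ₗ[K] UniversalEnvelopingAlgebra K g₂)))ᵐᵒᵖ :=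
  lift K
    { toFun := fun ζ => MulOpposite.op (M.ractStep ζ)
      map_add' := fun ζ ξ => by
        rw [← MulOpposite.op_add]
        refine congrArg _ (LinearMap.ext fun p => Prod.ext ?_ (LinearMap.ext fun X => ?_))
        · simp only [LinearMap.add_apply, Prod.fst_add, ractStep_fst, map_add, mul_add]
        · simp only [LinearMap.add_apply, Prod.snd_add, ractStep_snd, map_add, mul_add]
          abel
      map_smul' := fun c ζ => by
        rw [RingHom.id_apply, ← MulOpposite.op_smul]
        refine congrArg _ (LinearMap.ext fun p => Prod.ext ?_ (LinearMap.ext fun X => ?_))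
        · simp only [LinearMap.smul_apply, Prod.smul_fst, ractStep_fst, map_smul, mul_smul_comm]
        · simp only [LinearMap.smul_apply, Prod.smul_snd, ractStep_snd, map_smul, mul_smul_comm,
            smul_add]
      map_lie' := fun {ζ ξ} => by
        rw [LieRing.of_associative_ring_bracket, ← MulOpposite.op_mul, ← MulOpposite.op_mul,
          ← MulOpposite.op_sub]
        refine congrArg _ (LinearMap.ext fun p => Prod.ext ?_ (LinearMap.ext fun X => ?_))
        · simp only [LinearMap.sub_apply, Prod.fst_sub, Module.End.mul_apply, ractStep_fst,
            LieHom.map_lie, LieRing.of_associative_ring_bracket, mul_sub, mul_assoc]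
        · simp only [LinearMap.sub_apply, Prod.snd_sub, Module.End.mul_apply, ractStep_fst,
            ractStep_snd, LieHom.map_lie, LieRing.of_associative_ring_bracket, M.bracket_ract,
            M.bracket_lact, map_add, map_sub]
          noncomm_ring }

/-- The right action `v ◁ X` of `g₁` on `U(g₂)`: it is determined by `1 ◁ X = 0` and
`(v ζ) ◁ X = (v ◁ X) ζ + v ◁ (ζ ▷ X) + v (ζ ◁ X)`, and is the `U(g₂)`-component of `v X` when this
product in `U(g₁ ⋈ g₂) = U(g₁) ⊗ U(g₂)` is reordered (see `inrU_mul_ι_inl`). -/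
noncomputable def ractU (v : UniversalEnvelopingAlgebra K g₂) :
    g₁ →ₗ[K] UniversalEnvelopingAlgebra K g₂ :=
  ((M.ractStepHom v).unop (1, 0)).2

theorem ractStepHom_mul_ι (v : UniversalEnvelopingAlgebra K g₂) (ζ : g₂) (p) :
    (M.ractStepHom (v * ι K ζ)).unop p = M.ractStep ζ ((M.ractStepHom v).unop p) := by
  rw [map_mul, ractStepHom, lift_ι_apply]
  rfl

theorem ractStepHom_fst (v : UniversalEnvelopingAlgebra K g₂) :
    ((M.ractStepHom v).unop (1, 0)).1 = v := by
  induction v using induction_right with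
  | one => simp
  | add u v hu hv => simp [hu, hv]
  | smul c u hu => simp [hu]
  | mul u ζ hu =>
    rw [ractStepHom_mul_ι]
    change ((M.ractStepHom u).unop (1, 0)).1 * ι K ζ = _
    rw [hu]

theorem ractU_one (X : g₁) : M.ractU 1 X = 0 := by simp [ractU]

theorem ractU_add (v w : UniversalEnvelopingAlgebra K g₂) (X : g₁) :
    M.ractU (v + w) X = M.ractU v X + M.ractU w X := by simp [ractU]

theorem ractU_smul (c : K) (v : UniversalEnvelopingAlgebra K g₂) (X : g₁) :
    M.ractU (c • v) X = c • M.ractU v X := by simp [ractU]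

/-- The recursion that determines `v ◁ X`. -/
theorem ractU_mul_ι (v : UniversalEnvelopingAlgebra K g₂) (ζ : g₂) (X : g₁) :
    M.ractU (v * ι K ζ) X =
      M.ractU v X * ι K ζ + M.ractU v (M.lact ζ X) + v * ι K (M.ract ζ X) := by
  have h : M.ractU (v * ι K ζ) = (M.ractStep ζ ((M.ractStepHom v).unop (1, 0))).2 := by
    rw [ractU, ractStepHom_mul_ι]
  rw [h]
  change M.ractU v X * ι K ζ + M.ractU v (M.lact ζ X) +
    ((M.ractStepHom v).unop (1, 0)).1 * ι K (M.ract ζ X) = _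
  rw [ractStepHom_fst]

theorem ractU_ι (ζ : g₂) (X : g₁) : M.ractU (ι K ζ) X = ι K (M.ract ζ X) := by
  have := M.ractU_mul_ι 1 ζ X
  simpa [ractU_one, -ι_apply] using this

theorem ractU_bracket (v : UniversalEnvelopingAlgebra K g₂) (X Y : g₁) :
    M.ractU v ⁅X, Y⁆ = M.ractU (M.ractU v X) Y - M.ractU (M.ractU v Y) X := by
  induction v using induction_right generalizing X Y with
  | one => simp [ractU]
  | add u v hu hv => simp only [ractU_add, hu, hv]; abel
  | smul c u hu => simp only [ractU_smul, hu, smul_sub]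
  | mul u ζ hu =>
    simp only [ractU_mul_ι, ractU_add, M.lact_bracket, M.ract_bracket, map_add, map_sub, hu,
      mul_sub, sub_mul]
    abel

/-- The right action `v ◁ u` of `U(g₁)` on `U(g₂)`, as a map to the opposite of the endomorphism
algebra of `U(g₂)`. -/
noncomputable def ractUU : UniversalEnvelopingAlgebra K g₁ →ₐ[K]
    (Module.End K (UniversalEnvelopingAlgebra K g₂))ᵐᵒᵖ :=
  lift K
    { toFun := fun X => MulOpposite.op
        { toFun := fun v => M.ractU v X
          map_add' := fun v w => M.ractU_add v w X
          map_smul' := fun c v => M.ractU_smul c v X }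
      map_add' := fun X Y => by
        rw [← MulOpposite.op_add]
        exact congrArg _ (LinearMap.ext fun v => map_add (M.ractU v) X Y)
      map_smul' := fun c X => by
        rw [← MulOpposite.op_smul]
        exact congrArg _ (LinearMap.ext fun v => map_smul (M.ractU v) c X)
      map_lie' := fun {X Y} => by
        rw [LieRing.of_associative_ring_bracket, ← MulOpposite.op_mul, ← MulOpposite.op_mul,
          ← MulOpposite.op_sub]
        exact congrArg _ (LinearMap.ext fun v => M.ractU_bracket v X Y) }

/-- `v ◁ u` for `v ∈ U(g₂)` and `u ∈ U(g₁)`. -/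
noncomputable def rightAct (v : UniversalEnvelopingAlgebra K g₂)
    (u : UniversalEnvelopingAlgebra K g₁) : UniversalEnvelopingAlgebra K g₂ :=
  (M.ractUU u).unop v

theorem rightAct_ι (v : UniversalEnvelopingAlgebra K g₂) (X : g₁) :
    M.rightAct v (ι K X) = M.ractU v X := by
  rw [rightAct, ractUU, lift_ι_apply]; rfl

theorem rightAct_mul (v : UniversalEnvelopingAlgebra K g₂)
    (u w : UniversalEnvelopingAlgebra K g₁) :
    M.rightAct v (u * w) = M.rightAct (M.rightAct v u) w := by
  simp [rightAct]

theorem isRepresentative_lactU [FiniteDimensional K g₁] (X : g₁) (θ : g₁ →ₗ[K] K) :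
    IsRepresentative (θ ∘ₗ LinearMap.applyₗ X ∘ₗ M.lactU.toLinearMap) :=
  isRepresentative_comp M.lactU (θ ∘ₗ LinearMap.applyₗ X)

/-- The matrix coefficient `f_i^j(v) = ⟨v ▷ X_i, θ^j⟩`, where `(X_i)` is a basis of `g₁` and
`(θ^j)` is its dual basis. -/
noncomputable def coeff {κ : Type*} [Fintype κ] (b : Module.Basis κ K g₁) (i j : κ) :
    RepresentativeFunctions K g₂ :=
  haveI : FiniteDimensional K g₁ := b.finiteDimensional_of_finite
  FiniteDual.of _ (M.isRepresentative_lactU (b i) (b.coord j))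

theorem ev_coeff {κ : Type*} [Fintype κ] (b : Module.Basis κ K g₁) (i j : κ)
    (v : UniversalEnvelopingAlgebra K g₂) :
    ev v (M.coeff b i j) = b.coord j (M.lactU v (b i)) := rfl

/-- The coaction `X_i ↦ ∑ⱼ X_j ⊗ f_i^j`. -/
noncomputable def coaction {κ : Type*} [Fintype κ] (b : Module.Basis κ K g₁) :
    g₁ →ₗ[K] g₁ ⊗[K] RepresentativeFunctions K g₂ :=
  b.constr K fun i => ∑ j, b j ⊗ₜ[K] M.coeff b i j

end Actions

/-! The double crossed sum, in whose enveloping algebra the actions above arise by reordering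
products. -/

section DoubleCrossedSum

attribute [local instance 100] LieRing.ofAssociativeRing LieAlgebra.ofAssociativeAlgebra

variable {K : Type*} [Field K] {g₁ g₂ : Type*} [LieRing g₁] [LieAlgebra K g₁]
    [LieRing g₂] [LieAlgebra K g₂]

/-- The vector space `g₁ ⊕ g₂` underlying the double crossed sum. -/
def DoubleCrossedSum (_M : LieMatchedPair K g₁ g₂) : Type _ := g₁ × g₂

variable (M : LieMatchedPair K g₁ g₂)

instance : AddCommGroup M.DoubleCrossedSum := inferInstanceAs (AddCommGroup (g₁ × g₂))

instance : Module K M.DoubleCrossedSum := inferInstanceAs (Module K (g₁ × g₂))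

noncomputable instance : LieRing M.DoubleCrossedSum where
  bracket p q := ((⁅p.1, q.1⁆ + M.lact p.2 q.1 - M.lact q.2 p.1,
    ⁅p.2, q.2⁆ + M.ract p.2 q.1 - M.ract q.2 p.1) : g₁ × g₂)
  add_lie p q r := by
    refine Prod.ext ?_ ?_
    · change ⁅p.1 + q.1, r.1⁆ + M.lact (p.2 + q.2) r.1 - M.lact r.2 (p.1 + q.1) =
        (⁅p.1, r.1⁆ + M.lact p.2 r.1 - M.lact r.2 p.1) +
        (⁅q.1, r.1⁆ + M.lact q.2 r.1 - M.lact r.2 q.1)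
      simp only [add_lie, map_add, LinearMap.add_apply]; abel
    · change ⁅p.2 + q.2, r.2⁆ + M.ract (p.2 + q.2) r.1 - M.ract r.2 (p.1 + q.1) =
        (⁅p.2, r.2⁆ + M.ract p.2 r.1 - M.ract r.2 p.1) +
        (⁅q.2, r.2⁆ + M.ract q.2 r.1 - M.ract r.2 q.1)
      simp only [add_lie, map_add, LinearMap.add_apply]; abel
  lie_add p q r := by
    refine Prod.ext ?_ ?_
    · change ⁅p.1, q.1 + r.1⁆ + M.lact p.2 (q.1 + r.1) - M.lact (q.2 + r.2) p.1 =
        (⁅p.1, q.1⁆ + M.lact p.2 q.1 - M.lact q.2 p.1) +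
        (⁅p.1, r.1⁆ + M.lact p.2 r.1 - M.lact r.2 p.1)
      simp only [lie_add, map_add, LinearMap.add_apply]; abel
    · change ⁅p.2, q.2 + r.2⁆ + M.ract p.2 (q.1 + r.1) - M.ract (q.2 + r.2) p.1 =
        (⁅p.2, q.2⁆ + M.ract p.2 q.1 - M.ract q.2 p.1) +
        (⁅p.2, r.2⁆ + M.ract p.2 r.1 - M.ract r.2 p.1)
      simp only [lie_add, map_add, LinearMap.add_apply]; abel
  lie_self p := by
    refine Prod.ext ?_ ?_
    · change ⁅p.1, p.1⁆ + M.lact p.2 p.1 - M.lact p.2 p.1 = 0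
      simp
    · change ⁅p.2, p.2⁆ + M.ract p.2 p.1 - M.ract p.2 p.1 = 0
      simp
  leibniz_lie := by
    rintro ⟨X, ζ⟩ ⟨Y, ξ⟩ ⟨Z, ω⟩
    refine Prod.ext ?_ ?_
    · change ⁅X, ⁅Y, Z⁆ + M.lact ξ Z - M.lact ω Y⁆ + M.lact ζ (⁅Y, Z⁆ + M.lact ξ Z - M.lact ω Y) -
          M.lact (⁅ξ, ω⁆ + M.ract ξ Z - M.ract ω Y) X =
        (⁅⁅X, Y⁆ + M.lact ζ Y - M.lact ξ X, Z⁆ +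
          M.lact (⁅ζ, ξ⁆ + M.ract ζ Y - M.ract ξ X) Z -
          M.lact ω (⁅X, Y⁆ + M.lact ζ Y - M.lact ξ X)) +
        (⁅Y, ⁅X, Z⁆ + M.lact ζ Z - M.lact ω X⁆ + M.lact ξ (⁅X, Z⁆ + M.lact ζ Z - M.lact ω X) -
          M.lact (⁅ζ, ω⁆ + M.ract ζ Z - M.ract ω X) Y)
      simp only [lie_add, lie_sub, add_lie, sub_lie, map_add, map_sub, LinearMap.add_apply,
        LinearMap.sub_apply, M.lact_bracket, M.bracket_lact]
      rw [leibniz_lie X Y Z, ← lie_skew X (M.lact ω Y), ← lie_skew Y (M.lact ω X),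
        ← lie_skew X (M.lact ξ Z), ← lie_skew (M.lact ξ X) Z]
      simp only [← lie_skew Z (M.lact ξ X)]
      abel
    · change ⁅ζ, ⁅ξ, ω⁆ + M.ract ξ Z - M.ract ω Y⁆ + M.ract ζ (⁅Y, Z⁆ + M.lact ξ Z - M.lact ω Y) -
          M.ract (⁅ξ, ω⁆ + M.ract ξ Z - M.ract ω Y) X =
        (⁅⁅ζ, ξ⁆ + M.ract ζ Y - M.ract ξ X, ω⁆ +
          M.ract (⁅ζ, ξ⁆ + M.ract ζ Y - M.ract ξ X) Z -
          M.ract ω (⁅X, Y⁆ + M.lact ζ Y - M.lact ξ X)) +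
        (⁅ξ, ⁅ζ, ω⁆ + M.ract ζ Z - M.ract ω X⁆ + M.ract ξ (⁅X, Z⁆ + M.lact ζ Z - M.lact ω X) -
          M.ract (⁅ζ, ω⁆ + M.ract ζ Z - M.ract ω X) Y)
      simp only [lie_add, lie_sub, add_lie, sub_lie, map_add, map_sub, LinearMap.add_apply,
        LinearMap.sub_apply, M.ract_bracket, M.bracket_ract]
      rw [leibniz_lie ζ ξ ω]
      have h1 := lie_skew ξ (M.ract ζ Z)
      have h2 := lie_skew ξ (M.ract ω X)
      simp only [← h1, ← h2]
      abel

noncomputable instance : LieAlgebra K M.DoubleCrossedSum where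
  lie_smul c p q := by
    refine Prod.ext ?_ ?_
    · change ⁅p.1, c • q.1⁆ + M.lact p.2 (c • q.1) - M.lact (c • q.2) p.1 =
        c • (⁅p.1, q.1⁆ + M.lact p.2 q.1 - M.lact q.2 p.1)
      simp only [lie_smul, map_smul, LinearMap.smul_apply, smul_add, smul_sub]
    · change ⁅p.2, c • q.2⁆ + M.ract p.2 (c • q.1) - M.ract (c • q.2) p.1 =
        c • (⁅p.2, q.2⁆ + M.ract p.2 q.1 - M.ract q.2 p.1)
      simp only [lie_smul, map_smul, LinearMap.smul_apply, smul_add, smul_sub]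

/-- The inclusion of `g₁` in the double crossed sum. -/
def inl : g₁ →ₗ⁅K⁆ M.DoubleCrossedSum where
  toFun X := ((X, 0) : g₁ × g₂)
  map_add' X Y := Prod.ext rfl (add_zero (0 : g₂)).symm
  map_smul' c X := Prod.ext rfl (smul_zero c).symm
  map_lie' := by
    intro X Y
    refine Prod.ext ?_ ?_
    · change ⁅X, Y⁆ = ⁅X, Y⁆ + M.lact 0 Y - M.lact 0 X
      simp
    · change (0 : g₂) = ⁅(0 : g₂), 0⁆ + M.ract 0 Y - M.ract 0 X
      simp

/-- The inclusion of `g₂` in the double crossed sum. -/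
def inr : g₂ →ₗ⁅K⁆ M.DoubleCrossedSum where
  toFun ζ := ((0, ζ) : g₁ × g₂)
  map_add' ζ ξ := Prod.ext (add_zero (0 : g₁)).symm rfl
  map_smul' c ζ := Prod.ext (smul_zero c).symm rfl
  map_lie' := by
    intro ζ ξ
    refine Prod.ext ?_ ?_
    · change (0 : g₁) = ⁅(0 : g₁), 0⁆ + M.lact ζ 0 - M.lact ξ 0
      simp
    · change ⁅ζ, ξ⁆ = ⁅ζ, ξ⁆ + M.ract ζ 0 - M.ract ξ 0
      simp

theorem inr_bracket_inl (ζ : g₂) (X : g₁) :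
    ⁅M.inr ζ, M.inl X⁆ = M.inl (M.lact ζ X) + M.inr (M.ract ζ X) := by
  refine Prod.ext ?_ ?_
  · change ⁅(0 : g₁), X⁆ + M.lact ζ X - M.lact 0 0 = M.lact ζ X + 0
    simp
  · change ⁅ζ, (0 : g₂)⁆ + M.ract ζ X - M.ract 0 0 = 0 + M.ract ζ X
    simp

/-- The map `U(g₂) → U(g₁ ⋈ g₂)` induced by the inclusion. -/
noncomputable def inrU :
    UniversalEnvelopingAlgebra K g₂ →ₐ[K] UniversalEnvelopingAlgebra K M.DoubleCrossedSum :=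
  lift K ((ι K).comp M.inr)

theorem inrU_ι (ζ : g₂) : M.inrU (ι K ζ) = ι K (M.inr ζ) := by
  rw [inrU, lift_ι_apply]; rfl

/-- In `U(g₁ ⋈ g₂)` one has `v X = ∑ (v₁ ▷ X) v₂ + v ◁ X` for `v ∈ U(g₂)` and `X ∈ g₁`. -/
theorem inrU_mul_ι_inl (v : UniversalEnvelopingAlgebra K g₂) (X : g₁) :
    M.inrU v * ι K (M.inl X) =
      TensorProduct.lift ((LinearMap.mul K (UniversalEnvelopingAlgebra K M.DoubleCrossedSum)).compl₁₂
        ((ι K : M.DoubleCrossedSum →ₗ⁅K⁆ _).toLinearMap ∘ₗ M.inl.toLinearMap ∘ₗ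
          LinearMap.applyₗ X ∘ₗ M.lactU.toLinearMap) M.inrU.toLinearMap)
        (Coalgebra.comul v) + M.inrU (M.ractU v X) := by
  have tm : ∀ (Y : g₁) (a b : UniversalEnvelopingAlgebra K g₂),
      TensorProduct.lift ((LinearMap.mul K (UniversalEnvelopingAlgebra K M.DoubleCrossedSum)).compl₁₂
        ((ι K : M.DoubleCrossedSum →ₗ⁅K⁆ _).toLinearMap ∘ₗ M.inl.toLinearMap ∘ₗ
          LinearMap.applyₗ Y ∘ₗ M.lactU.toLinearMap) M.inrU.toLinearMap) (a ⊗ₜ b) =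
      ι K (M.inl (M.lactU a Y)) * M.inrU b := fun _ _ _ => rfl
  induction v using induction_right generalizing X with
  | one =>
    rw [Bialgebra.comul_one, Algebra.TensorProduct.one_def, tm, ractU_one]
    simp [-ι_apply]
  | add u v hu hv => simp only [map_add, add_mul, hu, hv, ractU_add]; abel
  | smul c u hu => simp only [map_smul, smul_mul_assoc, hu, ractU_smul, smul_add]
  | mul u ζ hu =>
    have key : ∀ t : UniversalEnvelopingAlgebra K g₂ ⊗[K] UniversalEnvelopingAlgebra K g₂,
        TensorProduct.lift ((LinearMap.mul K
            (UniversalEnvelopingAlgebra K M.DoubleCrossedSum)).compl₁₂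
          ((ι K : M.DoubleCrossedSum →ₗ⁅K⁆ _).toLinearMap ∘ₗ M.inl.toLinearMap ∘ₗ
            LinearMap.applyₗ X ∘ₗ M.lactU.toLinearMap) M.inrU.toLinearMap)
          (t * (ι K ζ ⊗ₜ 1 + 1 ⊗ₜ ι K ζ)) =
        TensorProduct.lift ((LinearMap.mul K
            (UniversalEnvelopingAlgebra K M.DoubleCrossedSum)).compl₁₂
          ((ι K : M.DoubleCrossedSum →ₗ⁅K⁆ _).toLinearMap ∘ₗ M.inl.toLinearMap ∘ₗ
            LinearMap.applyₗ (M.lact ζ X) ∘ₗ M.lactU.toLinearMap) M.inrU.toLinearMap) t +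
        TensorProduct.lift ((LinearMap.mul K
            (UniversalEnvelopingAlgebra K M.DoubleCrossedSum)).compl₁₂
          ((ι K : M.DoubleCrossedSum →ₗ⁅K⁆ _).toLinearMap ∘ₗ M.inl.toLinearMap ∘ₗ
            LinearMap.applyₗ X ∘ₗ M.lactU.toLinearMap) M.inrU.toLinearMap) t * M.inrU (ι K ζ) := by
      intro t
      induction t with
      | zero => simp
      | add s t hs ht => rw [add_mul, map_add, map_add, hs, ht, map_add, add_mul]; abel
      | tmul a b =>
        simp only [mul_add, Algebra.TensorProduct.tmul_mul_tmul, mul_one, map_add, tm, map_mul,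
          Module.End.mul_apply, lactU_ι, mul_assoc]
    have hc : M.inrU (ι K ζ) * ι K (M.inl X) = ι K (M.inl X) * M.inrU (ι K ζ) +
        ι K (M.inl (M.lact ζ X)) + M.inrU (ι K (M.ract ζ X)) := by
      have := LieHom.map_lie (ι K) (M.inr ζ) (M.inl X)
      rw [inr_bracket_inl, map_add, LieRing.of_associative_ring_bracket] at this
      rw [inrU_ι, inrU_ι, add_assoc, this]
      abel
    rw [Bialgebra.comul_mul, comul_ι, key, map_mul, mul_assoc, hc, mul_add, mul_add, ← mul_assoc,
      hu X, hu (M.lact ζ X), ractU_mul_ι, map_add, map_add, map_mul, map_mul, add_mul]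
    abel

end DoubleCrossedSum

end LieMatchedPair

/-! ### Matched pairs of Hopf algebras and Lie-Hopf algebras -/

/-- The canonical map of a Lie algebra to its enveloping algebra, as a linear map. -/
noncomputable def UniversalEnvelopingAlgebra.ιLin (K L : Type*) [Field K] [LieRing L]
    [LieAlgebra K L] : L →ₗ[K] UniversalEnvelopingAlgebra K L where
  toFun := UniversalEnvelopingAlgebra.ι K
  map_add' := map_add (UniversalEnvelopingAlgebra.ι K)
  map_smul' := map_smul (UniversalEnvelopingAlgebra.ι K)

section HopfMatchedPair

open Coalgebra LinearMap

variable {K : Type*} [Field K] {U F : Type*} [Ring U] [HopfAlgebra K U] [Ring F] [HopfAlgebra K F]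

/-- `f ⊗ u ↦ (g ↦ f (u ▷ g))` -/
noncomputable def mulAct (act : U →ₐ[K] Module.End K F) : F ⊗[K] U →ₗ[K] Module.End K F :=
  TensorProduct.lift
    ((LinearMap.mul K (Module.End K F)).compl₁₂ (LinearMap.mul K F) act.toLinearMap)

/-- `u ↦ u₁⟨0⟩ ⊗ (u₁⟨1⟩ ⊗ u₂)` -/
noncomputable def coactFst (coact : U →ₗ[K] U ⊗[K] F) : U →ₗ[K] U ⊗[K] (F ⊗[K] U) :=
  (TensorProduct.assoc K U F U).toLinearMap ∘ₗ coact.rTensor U ∘ₗ comul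

/-- `(U, F)` is a matched pair of Hopf algebras via the left action `act u f = u ▷ f` of `U` on `F`
and the right coaction `coact u = u⟨0⟩ ⊗ u⟨1⟩` of `F` on `U`. Here `homTensorHomMap` applies
`φ ⊗ ψ` to `x ⊗ y` as `φ x ⊗ ψ y`. -/
structure IsHopfMatchedPair (act : U →ₐ[K] Module.End K F) (coact : U →ₗ[K] U ⊗[K] F) :
    Prop where
  /-- `(u⟨0⟩)⟨0⟩ ⊗ (u⟨0⟩)⟨1⟩ ⊗ u⟨1⟩ = u⟨0⟩ ⊗ u⟨1⟩₁ ⊗ u⟨1⟩₂` -/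
  coact_coassoc : ∀ u, TensorProduct.assoc K U F F (coact.rTensor F (coact u)) =
    (comul (R := K) (A := F)).lTensor U (coact u)
  /-- `u⟨0⟩ ε(u⟨1⟩) = u` -/
  coact_counit : ∀ u,
    TensorProduct.rid K U ((counit (R := K) (A := F)).lTensor U (coact u)) = u
  /-- `u⟨0⟩₁ ⊗ u⟨0⟩₂ ⊗ u⟨1⟩ = u₁⟨0⟩ ⊗ u₂⟨0⟩ ⊗ u₁⟨1⟩ u₂⟨1⟩` -/
  comul_coact : ∀ u, (comul (R := K) (A := U)).rTensor F (coact u) =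
    (mul' K F).lTensor (U ⊗[K] U) (TensorProduct.tensorTensorTensorComm K U F U F
      (TensorProduct.map coact coact (comul u)))
  /-- `ε(u⟨0⟩) u⟨1⟩ = ε(u) 1` -/
  counit_coact : ∀ u, TensorProduct.lid K F ((counit (R := K) (A := U)).rTensor F (coact u)) =
    counit (R := K) u • (1 : F)
  /-- `u ▷ 1 = ε(u) 1` -/
  act_one : ∀ u, act u 1 = counit (R := K) u • (1 : F)
  /-- `u ▷ (f g) = (u₁ ▷ f) (u₂ ▷ g)` -/
  act_mul : ∀ u f g, act u (f * g) = mul' K F (TensorProduct.homTensorHomMap (RingHom.id K) F F F F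
    (TensorProduct.map act.toLinearMap act.toLinearMap (comul u)) (f ⊗ₜ g))
  /-- `ε(u ▷ f) = ε(u) ε(f)` -/
  counit_act : ∀ u f, counit (R := K) (act u f) = counit (R := K) u * counit (R := K) f
  /-- `Δ(u ▷ f) = u₁⟨0⟩ ▷ f₁ ⊗ u₁⟨1⟩ (u₂ ▷ f₂)` -/
  comul_act : ∀ u f, comul (R := K) (act u f) = TensorProduct.homTensorHomMap (RingHom.id K) F F F F
    (TensorProduct.map act.toLinearMap (mulAct act) (coactFst coact u)) (comul f)
  /-- `∇(1) = 1 ⊗ 1` -/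
  coact_one : coact 1 = 1 ⊗ₜ 1
  /-- `∇(u v) = u₁⟨0⟩ v⟨0⟩ ⊗ u₁⟨1⟩ (u₂ ▷ v⟨1⟩)` -/
  coact_mul : ∀ u v, coact (u * v) = TensorProduct.homTensorHomMap (RingHom.id K) U F U F
    (TensorProduct.map (LinearMap.mul K U) (mulAct act) (coactFst coact u)) (coact v)
  /-- `u₂⟨0⟩ ⊗ (u₁ ▷ f) u₂⟨1⟩ = u₁⟨0⟩ ⊗ u₁⟨1⟩ (u₂ ▷ f)` -/
  act_coact : ∀ u f, (mul' K F).lTensor U (TensorProduct.leftComm K F U F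
      (TensorProduct.map (act.toLinearMap.flip f) coact (comul u))) =
    (applyₗ f ∘ₗ mulAct act).lTensor U (coactFst coact u)

end HopfMatchedPair

section LieHopf

open Coalgebra LinearMap

variable {K : Type*} [Field K] {g F : Type*} [LieRing g] [LieAlgebra K g] [Ring F]
  [HopfAlgebra K F]

/-- The matrix coefficient `f_i^j ∈ F` of a linear map `∇ : g → g ⊗ F`, defined by
`∇(X_i) = ∑ⱼ X_j ⊗ f_i^j`. -/
noncomputable def matrixCoeff {κ : Type*} (b : Module.Basis κ K g) (coact : g →ₗ[K] g ⊗[K] F)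
    (i j : κ) : F :=
  TensorProduct.lid K F ((b.coord j).rTensor F (coact (b i)))

/-- `F` is a commutative `g`-Hopf algebra via the action `X ▷ f = act X f` of `g` on `F` and the
right coaction `coact X = X⟨0⟩ ⊗ X⟨1⟩` of `F` on `g`, where `b` is a finite basis `(X_i)` of `g`. -/
structure IsLieHopf {κ : Type*} [Fintype κ] (b : Module.Basis κ K g)
    (act : g →ₗ[K] Module.End K F) (coact : g →ₗ[K] g ⊗[K] F) : Prop where
  mul_comm : ∀ f h : F, f * h = h * f
  /-- `[X, Y] ▷ f = X ▷ (Y ▷ f) - Y ▷ (X ▷ f)` -/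
  act_lie : ∀ X Y f, act ⁅X, Y⁆ f = act X (act Y f) - act Y (act X f)
  /-- `g` acts by derivations. -/
  act_mul : ∀ X f h, act X (f * h) = act X f * h + f * act X h
  /-- `∇` is coassociative. -/
  coact_coassoc : ∀ X, TensorProduct.assoc K g F F (coact.rTensor F (coact X)) =
    (comul (R := K) (A := F)).lTensor g (coact X)
  /-- `∇` is counital. -/
  coact_counit : ∀ X,
    TensorProduct.rid K g ((counit (R := K) (A := F)).lTensor g (coact X)) = X
  /-- The structure identity `f_{j,i}^k - f_{i,j}^k = ∑ C_{s,r}^k f_i^r f_j^s + ∑ C_{i,j}^l f_l^k`,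
  where `f_{j,i}^k = X_i ▷ f_j^k` and `[X_i, X_j] = ∑ C_{i,j}^k X_k`. -/
  structure_identity : ∀ i j k : κ,
    act (b i) (matrixCoeff b coact j k) - act (b j) (matrixCoeff b coact i k) =
      ∑ s, ∑ r, b.repr ⁅b s, b r⁆ k • (matrixCoeff b coact i r * matrixCoeff b coact j s) +
      ∑ l, b.repr ⁅b i, b j⁆ l • matrixCoeff b coact l k
  /-- `Δ(X ▷ f) = X⟨0⟩ ▷ f₁ ⊗ X⟨1⟩ f₂ + f₁ ⊗ X ▷ f₂` -/
  comul_act : ∀ X f, comul (R := K) (act X f) =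
    TensorProduct.homTensorHomMap (RingHom.id K) F F F F
      (TensorProduct.map act (LinearMap.mul K F) (coact X)) (comul f) +
    (act X).lTensor F (comul f)
  /-- `ε(X ▷ f) = 0` -/
  counit_act : ∀ X f, counit (R := K) (act X f) = 0

end LieHopf

/-! Right induction on U(g₂) promotes the axioms of the Lie matched pair to three identities: v ↦ v
◁ X is a coderivation (`comul_ractU`), (v w) ◁ X = (v ◁ (w₁ ▷ X)) w₂ + v (w ◁ X) (`ractU_mul`), and
v ▷ [X, Y] = [v₁ ▷ X, v₂ ▷ Y] + (v ◁ X) ▷ Y - (v ◁ Y) ▷ X (`lactU_bracket`). Paired with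
representative functions they say respectively that X acts by derivations, that Δ(X ▷ f) has the
required form, and that the structure identity holds. It must also be seen that v ↦ f(v ◁ X) is
again representative. If f factors through a finite-dimensional quotient B of U(g₂), then the
classes of v and of all the v ◁ X together trace an orbit in a U(g₂)-module B × Hom(g₁, B), which is
finite-dimensional because g₁ is (`isRepresentative_comp_ractEnd`).

The passage to Hopf algebras works for every commutative g-Hopf algebra F. Since X ∈ g is primitive,
the product rule of a matched pair forces ∇(X u) = (X⟨0⟩ ⊗ X⟨1⟩) ∇(u) + (1 ⊗ X ▷) ∇(u), and this
gives uniqueness because g generates U(g) (`coactU_unique`). Conversely, these operators on U(g) ⊗ F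
represent g: this is the structure identity read as a Maurer-Cartan equation
(`structure_identity_tensor`, `coactStep_lie`). They therefore extend to U(g), and ∇(u) is defined
by letting u act on 1 ⊗ 1.

Most axioms then follow by left induction on u, since both sides obey the same recursion. The
formulas for ∇(u v) and Δ(u ▷ f) share one computation (`crossed_ι_mul`). The exchange axiom needs
no induction: it follows from cocommutativity of U(g) and commutativity of F (`act_coactU`). -/

namespace UniversalEnvelopingAlgebra

/-! ### Left induction and cocommutativity for enveloping algebras -/

section Hopf

attribute [local instance 100] LieRing.ofAssociativeRing LieAlgebra.ofAssociativeAlgebra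

variable {K : Type*} [Field K] {L : Type*} [LieRing L] [LieAlgebra K L]

/-- Induction from the left: `U(L)` is spanned by products of elements of `L`. -/
theorem induction_left {P : UniversalEnvelopingAlgebra K L → Prop}
    (one : P 1) (add : ∀ u v, P u → P v → P (u + v)) (smul : ∀ (c : K) u, P u → P (c • u))
    (mul : ∀ (x : L) u, P u → P (ι K x * u)) (u : UniversalEnvelopingAlgebra K L) : P u := by
  -- The claim is strengthened to stability of P under left multiplication by u, so that right
  -- induction can hand the last factor of u over to v.
  have key : ∀ v, P v → P (u * v) := by
    induction u using induction_right with
    | one => intro v hv; rwa [one_mul]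
    | add a b ha hb => intro v hv; rw [add_mul]; exact add _ _ (ha v hv) (hb v hv)
    | smul c a ha => intro v hv; rw [smul_mul_assoc]; exact smul _ _ (ha v hv)
    | mul a x ha => intro v hv; rw [mul_assoc]; exact ha _ (mul x v hv)
  simpa using key 1 one

/-- The flip of Δ and Δ itself are algebra maps that agree on the primitive generators. For g₂ this
makes R(g₂) commutative; for g₁ it yields the exchange axiom. -/
instance : Coalgebra.IsCocomm K (UniversalEnvelopingAlgebra K L) where
  comm_comp_comul := by
    have : ((Algebra.TensorProduct.comm K (UniversalEnvelopingAlgebra K L)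
        (UniversalEnvelopingAlgebra K L)).toAlgHom.comp comulHom) = comulHom := by
      refine algHom_ext fun x => ?_
      change Algebra.TensorProduct.comm K _ _ (comulHom (ι K x)) = comulHom (ι K x)
      rw [comulHom_ι, map_add, Algebra.TensorProduct.comm_tmul, Algebra.TensorProduct.comm_tmul,
        add_comm]
    exact congrArg AlgHom.toLinearMap this

end Hopf

end UniversalEnvelopingAlgebra

/-! ### Convolution of representative functions -/

namespace FiniteDual

variable {K : Type*} [Field K] {A : Type*} [Ring A] [HopfAlgebra K A]

/-- Convolution of functionals on a cocommutative coalgebra is commutative, and the finite dual is a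
subalgebra of the convolution algebra. -/
theorem mul_comm [Coalgebra.IsCocomm K A] (f g : FiniteDual K A) : f * g = g * f :=
  Subtype.ext (_root_.mul_comm
    (Subtype.val (p := fun g => g ∈ finiteDualSubalgebra K A) f)
    (Subtype.val (p := fun g => g ∈ finiteDualSubalgebra K A) g))

/-- The convolution product, paired with an element, factors through the comultiplication. -/
theorem ev_mul_eq (a : A) (f g : FiniteDual K A) : ev a (f * g) =
    LinearMap.mul' K K (TensorProduct.map f.toLinearMap g.toLinearMap
      (Coalgebra.comul (R := K) a)) := rfl

end FiniteDual

/-! ### The matched pair identities on U(g₂) -/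

namespace LieMatchedPair

open UniversalEnvelopingAlgebra FiniteDual

section Actions

attribute [local instance 100] LieRing.ofAssociativeRing LieAlgebra.ofAssociativeAlgebra

variable {K : Type*} [Field K] {g₁ g₂ : Type*} [LieRing g₁] [LieAlgebra K g₁]
    [LieRing g₂] [LieAlgebra K g₂] (M : LieMatchedPair K g₁ g₂)

/-- The endomorphism `v ↦ v ◁ X` of `U(g₂)`. -/
noncomputable def ractEnd (X : g₁) : Module.End K (UniversalEnvelopingAlgebra K g₂) where
  toFun v := M.ractU v X
  map_add' v w := M.ractU_add v w X
  map_smul' c v := M.ractU_smul c v X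

theorem ractEnd_apply (X : g₁) (v : UniversalEnvelopingAlgebra K g₂) :
    M.ractEnd X v = M.ractU v X := rfl

/-- `g₁` acts on `U(g₂)` by coderivations: `Δ(v ◁ X) = v₁ ◁ X ⊗ v₂ + v₁ ⊗ v₂ ◁ X`. -/
theorem comul_ractU (v : UniversalEnvelopingAlgebra K g₂) (X : g₁) :
    Coalgebra.comul (R := K) (M.ractU v X) =
      (M.ractEnd X).rTensor _ (Coalgebra.comul (R := K) v) +
        (M.ractEnd X).lTensor _ (Coalgebra.comul (R := K) v) := by
  induction v using induction_right generalizing X with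
  | one =>
    simp [ractU_one, Bialgebra.comul_one, Algebra.TensorProduct.one_def, ractEnd_apply]
  | add u v hu hv => simp only [ractU_add, map_add, hu, hv]; abel
  | smul c u hu => simp only [ractU_smul, map_smul, hu, smul_add]
  | mul u ζ hu =>
    -- The sum of `M.ractEnd X` on the two tensor factors obeys, against right multiplication by
    -- Δ(ζ), the recursion that `M.ractEnd X` obeys against ζ. The recursion also involves ζ ▷ X,
    -- which is why X varies in the induction.
    have key : ∀ t : UniversalEnvelopingAlgebra K g₂ ⊗[K] UniversalEnvelopingAlgebra K g₂,
        (M.ractEnd X).rTensor _ (t * (ι K ζ ⊗ₜ 1 + 1 ⊗ₜ ι K ζ)) +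
          (M.ractEnd X).lTensor _ (t * (ι K ζ ⊗ₜ 1 + 1 ⊗ₜ ι K ζ)) =
        ((M.ractEnd X).rTensor _ t + (M.ractEnd X).lTensor _ t) * (ι K ζ ⊗ₜ 1 + 1 ⊗ₜ ι K ζ) +
        ((M.ractEnd (M.lact ζ X)).rTensor _ t + (M.ractEnd (M.lact ζ X)).lTensor _ t) +
        t * (ι K (M.ract ζ X) ⊗ₜ 1 + 1 ⊗ₜ ι K (M.ract ζ X)) := by
      intro t
      induction t with
      | zero => simp
      | add s t hs ht =>
        simp only [add_mul, map_add] at hs ht ⊢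
        rw [add_add_add_comm, hs, ht]; abel
      | tmul a b =>
        simp only [mul_add, add_mul, Algebra.TensorProduct.tmul_mul_tmul, mul_one, map_add,
          LinearMap.rTensor_tmul, LinearMap.lTensor_tmul, ractEnd_apply, ractU_mul_ι,
          TensorProduct.add_tmul, TensorProduct.tmul_add]
        abel
    rw [ractU_mul_ι, map_add, map_add, Bialgebra.comul_mul, Bialgebra.comul_mul,
      Bialgebra.comul_mul, comul_ι, comul_ι, key, hu, hu]

/-- `a ⊗ b ↦ (v ◁ (a ▷ X)) b` -/
noncomputable def ractLact (v : UniversalEnvelopingAlgebra K g₂) (X : g₁) :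
    UniversalEnvelopingAlgebra K g₂ ⊗[K] UniversalEnvelopingAlgebra K g₂ →ₗ[K]
      UniversalEnvelopingAlgebra K g₂ :=
  TensorProduct.lift ((LinearMap.mul K (UniversalEnvelopingAlgebra K g₂)).compl₁₂
    (M.ractU v ∘ₗ LinearMap.applyₗ X ∘ₗ M.lactU.toLinearMap) LinearMap.id)

theorem ractLact_tmul (v a b : UniversalEnvelopingAlgebra K g₂) (X : g₁) :
    M.ractLact v X (a ⊗ₜ b) = M.ractU v (M.lactU a X) * b := rfl

/-- `(v w) ◁ X = (v ◁ (w₁ ▷ X)) w₂ + v (w ◁ X)` -/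
theorem ractU_mul (v w : UniversalEnvelopingAlgebra K g₂) (X : g₁) :
    M.ractU (v * w) X = M.ractLact v X (Coalgebra.comul (R := K) w) + v * M.ractU w X := by
  induction w using induction_right generalizing X with
  | one =>
    simp [ractU_one, Bialgebra.comul_one, Algebra.TensorProduct.one_def, ractLact_tmul]
  | add u w hu hw => simp only [mul_add, ractU_add, map_add, hu, hw]; abel
  | smul c u hu => simp only [mul_smul_comm, ractU_smul, map_smul, hu, smul_add]
  | mul u ζ hu =>
    -- A factor ζ in the first slot reaches X before the rest and turns it into ζ ▷ X; in the second
    -- slot it is a right factor of the result. These are the first two terms of the recursion for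
    -- ◁.
    have key : ∀ t : UniversalEnvelopingAlgebra K g₂ ⊗[K] UniversalEnvelopingAlgebra K g₂,
        M.ractLact v X (t * (ι K ζ ⊗ₜ 1 + 1 ⊗ₜ ι K ζ)) =
          M.ractLact v X t * ι K ζ + M.ractLact v (M.lact ζ X) t := by
      intro t
      induction t with
      | zero => simp
      | add s t hs ht => simp only [add_mul, map_add, hs, ht]; abel
      | tmul a b =>
        simp only [mul_add, Algebra.TensorProduct.tmul_mul_tmul, mul_one, map_add,
          ractLact_tmul, map_mul, Module.End.mul_apply, lactU_ι, mul_assoc]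
        rw [add_comm]
    rw [← mul_assoc, ractU_mul_ι, hu, hu, Bialgebra.comul_mul, comul_ι, key, ractU_mul_ι]
    simp only [add_mul, mul_add, mul_assoc]
    abel

/-- `a ⊗ b ↦ [a ▷ X, b ▷ Y]` -/
noncomputable def bracketLact (X Y : g₁) :
    UniversalEnvelopingAlgebra K g₂ ⊗[K] UniversalEnvelopingAlgebra K g₂ →ₗ[K] g₁ :=
  TensorProduct.lift ((LieModule.toEnd K g₁ g₁).toLinearMap.compl₁₂
    (LinearMap.applyₗ X ∘ₗ M.lactU.toLinearMap) (LinearMap.applyₗ Y ∘ₗ M.lactU.toLinearMap))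

theorem bracketLact_tmul (a b : UniversalEnvelopingAlgebra K g₂) (X Y : g₁) :
    M.bracketLact X Y (a ⊗ₜ b) = ⁅M.lactU a X, M.lactU b Y⁆ := rfl

/-- `v ▷ [X, Y] = [v₁ ▷ X, v₂ ▷ Y] + (v ◁ X) ▷ Y - (v ◁ Y) ▷ X` -/
theorem lactU_bracket (v : UniversalEnvelopingAlgebra K g₂) (X Y : g₁) :
    M.lactU v ⁅X, Y⁆ = M.bracketLact X Y (Coalgebra.comul (R := K) v) +
      M.lactU (M.ractU v X) Y - M.lactU (M.ractU v Y) X := by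
  induction v using induction_right generalizing X Y with
  | one =>
    simp [ractU_one, Bialgebra.comul_one, Algebra.TensorProduct.one_def, bracketLact_tmul]
  | add u w hu hw => simp only [ractU_add, map_add, LinearMap.add_apply, hu, hw]; abel
  | smul c u hu =>
    simp only [ractU_smul, map_smul, LinearMap.smul_apply, hu, smul_add, smul_sub]
  | mul u ζ hu =>
    -- Being primitive, ζ acts on the bracket through X or through Y. The two correction terms of
    -- `M.lact_bracket` are matched by the summands u (ζ ◁ X) and u (ζ ◁ Y) of the recursion for ◁.
    have key : ∀ t : UniversalEnvelopingAlgebra K g₂ ⊗[K] UniversalEnvelopingAlgebra K g₂,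
        M.bracketLact X Y (t * (ι K ζ ⊗ₜ 1 + 1 ⊗ₜ ι K ζ)) =
          M.bracketLact (M.lact ζ X) Y t + M.bracketLact X (M.lact ζ Y) t := by
      intro t
      induction t with
      | zero => simp
      | add s t hs ht => simp only [add_mul, map_add, hs, ht]; abel
      | tmul a b =>
        simp only [mul_add, Algebra.TensorProduct.tmul_mul_tmul, mul_one, map_add,
          bracketLact_tmul, map_mul, Module.End.mul_apply, lactU_ι]
    rw [Bialgebra.comul_mul, comul_ι, key]
    simp only [map_mul, Module.End.mul_apply, lactU_ι, ractU_mul_ι, M.lact_bracket, map_add,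
      map_sub, LinearMap.add_apply, hu]
    abel

/-! ### Stability of representative functions under the action of g₁ -/

/-- The representation by which `v ↦ π(v ◁ X)` is seen to factor through a finite-dimensional
algebra if `π` does: right multiplication by `ζ` on pairs `(p, D)`, `D` standing for
`X ↦ π(v ◁ X)`. -/
noncomputable def ractStepQuot {B : Type*} [Ring B] [Algebra K B]
    (π : UniversalEnvelopingAlgebra K g₂ →ₐ[K] B) (ζ : g₂) :
    (B × (g₁ →ₗ[K] B)) →ₗ[K] (B × (g₁ →ₗ[K] B)) where
  toFun p := (p.1 * π (ι K ζ), LinearMap.mulRight K (π (ι K ζ)) ∘ₗ p.2 + p.2 ∘ₗ M.lact ζ +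
    LinearMap.mulLeft K p.1 ∘ₗ π.toLinearMap ∘ₗ (ι K).toLinearMap ∘ₗ M.ract ζ)
  map_add' p q := by
    refine Prod.ext ?_ (LinearMap.ext fun X => ?_)
    · simp [add_mul, -ι_apply]
    · simp [add_mul, -ι_apply]
      abel
  map_smul' c p := by
    refine Prod.ext ?_ (LinearMap.ext fun X => ?_)
    · simp [-ι_apply]
    · simp [-ι_apply]

theorem ractStepQuot_fst {B : Type*} [Ring B] [Algebra K B]
    (π : UniversalEnvelopingAlgebra K g₂ →ₐ[K] B) (ζ : g₂) (p) :
    (M.ractStepQuot π ζ p).1 = p.1 * π (ι K ζ) := rfl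

theorem ractStepQuot_snd {B : Type*} [Ring B] [Algebra K B]
    (π : UniversalEnvelopingAlgebra K g₂ →ₐ[K] B) (ζ : g₂) (p) (X : g₁) :
    (M.ractStepQuot π ζ p).2 X =
      p.2 X * π (ι K ζ) + p.2 (M.lact ζ X) + p.1 * π (ι K (M.ract ζ X)) := rfl

/-- The right `U(g₂)`-module structure given by `ractStepQuot`. -/
noncomputable def ractStepQuotHom {B : Type*} [Ring B] [Algebra K B]
    (π : UniversalEnvelopingAlgebra K g₂ →ₐ[K] B) :
    UniversalEnvelopingAlgebra K g₂ →ₐ[K] (Module.End K (B × (g₁ →ₗ[K] B)))ᵐᵒᵖ :=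
  lift K
    { toFun := fun ζ => MulOpposite.op (M.ractStepQuot π ζ)
      map_add' := fun ζ ξ => by
        rw [← MulOpposite.op_add]
        refine congrArg _ (LinearMap.ext fun p => Prod.ext ?_ (LinearMap.ext fun X => ?_))
        · simp only [LinearMap.add_apply, Prod.fst_add, ractStepQuot_fst, map_add, mul_add]
        · simp only [LinearMap.add_apply, Prod.snd_add, ractStepQuot_snd, map_add, mul_add]
          abel
      map_smul' := fun c ζ => by
        rw [RingHom.id_apply, ← MulOpposite.op_smul]
        refine congrArg _ (LinearMap.ext fun p => Prod.ext ?_ (LinearMap.ext fun X => ?_))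
        · simp only [LinearMap.smul_apply, Prod.smul_fst, ractStepQuot_fst, map_smul,
            mul_smul_comm]
        · simp only [LinearMap.smul_apply, Prod.smul_snd, ractStepQuot_snd, map_smul,
            mul_smul_comm, smul_add]
      map_lie' := fun {ζ ξ} => by
        rw [LieRing.of_associative_ring_bracket, ← MulOpposite.op_mul, ← MulOpposite.op_mul,
          ← MulOpposite.op_sub]
        refine congrArg _ (LinearMap.ext fun p => Prod.ext ?_ (LinearMap.ext fun X => ?_))
        · simp only [LinearMap.sub_apply, Prod.fst_sub, Module.End.mul_apply, ractStepQuot_fst,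
            LieHom.map_lie, LieRing.of_associative_ring_bracket, mul_sub, mul_assoc, map_sub,
            map_mul]
        · simp only [LinearMap.sub_apply, Prod.snd_sub, Module.End.mul_apply, ractStepQuot_fst,
            ractStepQuot_snd, LieHom.map_lie, LieRing.of_associative_ring_bracket,
            M.bracket_ract, M.bracket_lact, map_add, map_sub, map_mul]
          noncomm_ring }

theorem ractStepQuotHom_mul_ι {B : Type*} [Ring B] [Algebra K B]
    (π : UniversalEnvelopingAlgebra K g₂ →ₐ[K] B) (v : UniversalEnvelopingAlgebra K g₂)
    (ζ : g₂) (p) :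
    (M.ractStepQuotHom π (v * ι K ζ)).unop p =
      M.ractStepQuot π ζ ((M.ractStepQuotHom π v).unop p) := by
  rw [map_mul, ractStepQuotHom, lift_ι_apply]
  rfl

/-- Both sides equal (1, 0) at v = 1 and obey the recursion for ◁ pushed forward along π. Hence π(v
◁ X) is read off from the operator by which v acts on B × Hom(g₁, B). -/
theorem ractStepQuotHom_apply {B : Type*} [Ring B] [Algebra K B]
    (π : UniversalEnvelopingAlgebra K g₂ →ₐ[K] B) (v : UniversalEnvelopingAlgebra K g₂) :
    (M.ractStepQuotHom π v).unop (1, 0) = (π v, π.toLinearMap ∘ₗ M.ractU v) := by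
  induction v using induction_right with
  | one =>
    refine Prod.ext (by simp) (LinearMap.ext fun X => ?_)
    simp [ractU_one]
  | add u v hu hv =>
    rw [map_add, MulOpposite.unop_add, LinearMap.add_apply, hu, hv]
    refine Prod.ext (by simp) (LinearMap.ext fun X => ?_)
    simp [ractU_add]
  | smul c u hu =>
    rw [map_smul, MulOpposite.unop_smul, LinearMap.smul_apply, hu]
    refine Prod.ext (by simp) (LinearMap.ext fun X => ?_)
    simp [ractU_smul]
  | mul u ζ hu =>
    rw [ractStepQuotHom_mul_ι, hu]
    refine Prod.ext ?_ (LinearMap.ext fun X => ?_)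
    · simp only [ractStepQuot_fst, map_mul]
    · simp only [ractStepQuot_snd, LinearMap.comp_apply, AlgHom.toLinearMap_apply, ractU_mul_ι,
        map_add, map_mul]

/-- Take π to be the quotient by an ideal of finite codimension killed by f. Then B × Hom(g₁, B) is
finite-dimensional, and f(v ◁ X) is a linear functional of the operator of v on it: apply the
operator to (1, 0), take the second component at X, and pair with φ. -/
theorem isRepresentative_comp_ractEnd [FiniteDimensional K g₁]
    {f : UniversalEnvelopingAlgebra K g₂ →ₗ[K] K} (hf : IsRepresentative f) (X : g₁) :
    IsRepresentative (f ∘ₗ M.ractEnd X) := by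
  obtain ⟨I, _, _, φ, rfl⟩ := hf.exists_comp
  let π := Ideal.Quotient.mkₐ K I
  have : (φ ∘ₗ π.toLinearMap) ∘ₗ M.ractEnd X =
      (φ ∘ₗ LinearMap.applyₗ X ∘ₗ LinearMap.snd K _ _ ∘ₗ LinearMap.applyₗ (1, 0) ∘ₗ
        (MulOpposite.opLinearEquiv K).symm.toLinearMap) ∘ₗ
        (M.ractStepQuotHom π).toLinearMap := by
    refine LinearMap.ext fun v => ?_
    have := M.ractStepQuotHom_apply π v
    simp only [LinearMap.comp_apply, AlgHom.toLinearMap_apply, LinearEquiv.coe_coe,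
      MulOpposite.coe_opLinearEquiv_symm, LinearMap.applyₗ_apply_apply, LinearMap.snd_apply,
      this, ractEnd_apply]
  change IsRepresentative ((φ ∘ₗ π.toLinearMap) ∘ₗ M.ractEnd X)
  rw [this]
  exact isRepresentative_comp _ _

end Actions

end LieMatchedPair

/-! ### R(g₂) as a g₁-Hopf algebra -/

namespace LieMatchedPair

open UniversalEnvelopingAlgebra FiniteDual

section Actions

attribute [local instance 100] LieRing.ofAssociativeRing LieAlgebra.ofAssociativeAlgebra

variable {K : Type*} [Field K] {g₁ g₂ : Type*} [LieRing g₁] [LieAlgebra K g₁]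
    [LieRing g₂] [LieAlgebra K g₂] (M : LieMatchedPair K g₁ g₂)

/-- The operator `(X ▷ f)(v) = f(v ◁ X)` on representative functions. -/
noncomputable def derivRep [FiniteDimensional K g₁] (X : g₁) :
    Module.End K (RepresentativeFunctions K g₂) where
  toFun f := FiniteDual.of (f.toLinearMap ∘ₗ M.ractEnd X)
    (M.isRepresentative_comp_ractEnd f.isRepresentative X)
  map_add' _ _ := rfl
  map_smul' _ _ := rfl

theorem ev_derivRep [FiniteDimensional K g₁] (X : g₁) (f : RepresentativeFunctions K g₂)
    (v : UniversalEnvelopingAlgebra K g₂) :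
    ev v (M.derivRep X f) = ev (M.ractU v X) f := rfl

/-- The left action of `U(g₁)` on `R(g₂)`. -/
noncomputable def actRep [FiniteDimensional K g₁] :
    UniversalEnvelopingAlgebra K g₁ →ₐ[K] Module.End K (RepresentativeFunctions K g₂) :=
  lift K
    { toFun := M.derivRep
      map_add' := fun X Y => LinearMap.ext fun f => ext_ev fun v => by
        rw [LinearMap.add_apply, map_add, ev_derivRep, ev_derivRep, ev_derivRep, map_add, ev_add]
      map_smul' := fun c X => LinearMap.ext fun f => ext_ev fun v => by
        rw [RingHom.id_apply, LinearMap.smul_apply, map_smul, ev_derivRep, ev_derivRep, map_smul,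
          ev_smul, smul_eq_mul]
      map_lie' := fun {X Y} => LinearMap.ext fun f => ext_ev fun v => by
        rw [LieRing.of_associative_ring_bracket, LinearMap.sub_apply, map_sub,
          Module.End.mul_apply, Module.End.mul_apply, ev_derivRep, ev_derivRep, ev_derivRep,
          ev_derivRep, ev_derivRep, ractU_bracket]
        exact map_sub f.toLinearMap _ _ }

theorem actRep_ι [FiniteDimensional K g₁] (X : g₁) : M.actRep (ι K X) = M.derivRep X :=
  lift_ι_apply K _ X

/-- Transposition turns a right action into a left one: u ▷ (X ▷ f) takes at v the value f((v ◁ u) ◁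
X). The function varies in the induction because f is replaced by X ▷ f. -/
theorem ev_actRep [FiniteDimensional K g₁] (u : UniversalEnvelopingAlgebra K g₁)
    (f : RepresentativeFunctions K g₂) (v : UniversalEnvelopingAlgebra K g₂) :
    ev v (M.actRep u f) = ev (M.rightAct v u) f := by
  induction u using induction_right generalizing f with
  | one => simp [rightAct]
  | add u w hu hw =>
    rw [map_add, LinearMap.add_apply, map_add, hu, hw, ← ev_add, rightAct, rightAct, rightAct,
      map_add, MulOpposite.unop_add, LinearMap.add_apply]
  | smul c u hu =>
    rw [map_smul, LinearMap.smul_apply, map_smul, hu, smul_eq_mul, ← ev_smul, rightAct, rightAct,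
      map_smul, MulOpposite.unop_smul, LinearMap.smul_apply]
  | mul u X hu =>
    rw [map_mul, Module.End.mul_apply, hu, actRep_ι, ev_derivRep, rightAct_mul, rightAct_ι]

/-- Dual to the coderivation property `comul_ractU`. -/
theorem derivRep_mul [FiniteDimensional K g₁] (X : g₁) (f h : RepresentativeFunctions K g₂) :
    M.derivRep X (f * h) = M.derivRep X f * h + f * M.derivRep X h := by
  refine ext_ev fun v => ?_
  rw [ev_derivRep, map_add, ev_mul_eq, ev_mul_eq, ev_mul_eq, comul_ractU]
  generalize Coalgebra.comul (R := K) v = t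
  induction t with
  | zero => simp
  | add s t hs ht =>
    simp only [map_add] at hs ht ⊢
    rw [add_add_add_comm, hs, ht, add_add_add_comm]
  | tmul a b => rfl

variable {κ : Type*} [Fintype κ] (b : Module.Basis κ K g₁)

theorem map_eq_sum_repr {W : Type*} [AddCommGroup W] [Module K W] (φ : g₁ →ₗ[K] W) (X : g₁) :
    φ X = ∑ j, b.repr X j • φ (b j) := by
  conv_lhs => rw [← b.sum_repr X]
  rw [map_sum]
  exact Finset.sum_congr rfl fun j _ => map_smul _ _ _

theorem coaction_basis (i : κ) : M.coaction b (b i) = ∑ j, b j ⊗ₜ[K] M.coeff b i j :=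
  b.constr_basis K _ i

theorem matrixCoeff_coaction (i j : κ) : matrixCoeff b (M.coaction b) i j = M.coeff b i j := by
  classical
  simp [matrixCoeff, coaction_basis, Finsupp.single_apply, ite_smul]

/-- `X⟨0⟩ X⟨1⟩(v) = v ▷ X` -/
theorem rid_lTensor_ev_coaction (v : UniversalEnvelopingAlgebra K g₂) (X : g₁) :
    TensorProduct.rid K g₁ ((ev v).lTensor g₁ (M.coaction b X)) = M.lactU v X := by
  have : (TensorProduct.rid K g₁).toLinearMap ∘ₗ (ev v).lTensor g₁ ∘ₗ M.coaction b =
      M.lactU v := by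
    refine b.ext fun i => ?_
    simp only [LinearMap.comp_apply, coaction_basis, map_sum, LinearMap.lTensor_tmul,
      LinearEquiv.coe_coe, TensorProduct.rid_tmul, ev_coeff]
    exact b.sum_repr _
  exact LinearMap.congr_fun this X

/-- Since (v w) ▷ X_i = v ▷ (w ▷ X_i), the matrices of the action multiply, which dualizes to Δ
f_i^k = ∑ⱼ f_j^k ⊗ f_i^j. -/
theorem coaction_coassoc (X : g₁) :
    TensorProduct.assoc K g₁ _ _ ((M.coaction b).rTensor _ (M.coaction b X)) =
      (Coalgebra.comul (R := K) (A := RepresentativeFunctions K g₂)).lTensor g₁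
        (M.coaction b X) := by
  have key : ∀ i k, Coalgebra.comul (R := K) (M.coeff b i k) =
      ∑ j, M.coeff b j k ⊗ₜ[K] M.coeff b i j := by
    intro i k
    refine ext_slice₂ fun v w => ?_
    simp only [ev_comul, map_sum, slice_tmul, map_smul, ev_coeff, map_mul, Module.End.mul_apply,
      smul_eq_mul]
    change (b.coord k ∘ₗ M.lactU v) (M.lactU w (b i)) = _
    rw [map_eq_sum_repr b (b.coord k ∘ₗ M.lactU v) (M.lactU w (b i))]
    exact Finset.sum_congr rfl fun j _ => _root_.mul_comm _ _
  have : (TensorProduct.assoc K g₁ _ _).toLinearMap ∘ₗ (M.coaction b).rTensor _ ∘ₗ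
      M.coaction b =
      (Coalgebra.comul (R := K) (A := RepresentativeFunctions K g₂)).lTensor g₁ ∘ₗ
        M.coaction b := by
    refine b.ext fun i => ?_
    simp only [LinearMap.comp_apply, coaction_basis, map_sum, LinearMap.lTensor_tmul,
      LinearMap.rTensor_tmul, LinearEquiv.coe_coe, TensorProduct.sum_tmul,
      TensorProduct.assoc_tmul, key, TensorProduct.tmul_sum]
    rw [Finset.sum_comm]
  exact LinearMap.congr_fun this X

/-- Evaluated at v, this is the k-th coordinate of `lactU_bracket` for X_i and X_j, because (X_i ▷
f_j^k)(v) is the k-th coordinate of (v ◁ X_i) ▷ X_j. -/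
theorem structure_identity_coeff [FiniteDimensional K g₁] (i j k : κ) :
    M.derivRep (b i) (M.coeff b j k) - M.derivRep (b j) (M.coeff b i k) =
      ∑ s, ∑ r, b.repr ⁅b s, b r⁆ k • (M.coeff b i r * M.coeff b j s) +
      ∑ l, b.repr ⁅b i, b j⁆ l • M.coeff b l k := by
  refine ext_ev fun v => ?_
  have h1 : ev v (∑ l, b.repr ⁅b i, b j⁆ l • M.coeff b l k) =
      b.coord k (M.lactU v ⁅b i, b j⁆) := by
    change _ = (b.coord k ∘ₗ M.lactU v) ⁅b i, b j⁆
    rw [map_eq_sum_repr b, map_sum]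
    rfl
  -- In C_{s,r}^k f_i^r f_j^s the index s, coming from X_j, stands first. The sum therefore computes
  -- [v₂ ▷ X_j, v₁ ▷ X_i], whence the minus sign.
  have h2 : ∀ t, ∑ s, ∑ r, b.repr ⁅b s, b r⁆ k •
      LinearMap.mul' K K (TensorProduct.map (M.coeff b i r).toLinearMap
        (M.coeff b j s).toLinearMap t) = - b.coord k (M.bracketLact (b i) (b j) t) := by
    intro t
    induction t with
    | zero => simp
    | add s t hs ht => simp only [map_add, smul_add, Finset.sum_add_distrib, hs, ht, neg_add]
    | tmul a c =>
      have h3 : ∀ i r (a : UniversalEnvelopingAlgebra K g₂),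
          (M.coeff b i r).toLinearMap a = b.repr (M.lactU a (b i)) r := fun _ _ _ => rfl
      rw [bracketLact_tmul, ← map_neg, lie_skew, ← b.sum_repr (M.lactU c (b j)),
        ← b.sum_repr (M.lactU a (b i))]
      simp only [TensorProduct.map_tmul, LinearMap.mul'_apply, h3,
        sum_lie, lie_sum, smul_lie, lie_smul, map_sum, map_smul, Module.Basis.coord_apply,
        smul_eq_mul, Finset.mul_sum]
      rw [Finset.sum_comm]
      refine Finset.sum_congr rfl fun s _ => Finset.sum_congr rfl fun r _ => ?_
      ring
  rw [map_add, h1, M.lactU_bracket]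
  simp only [map_sum, map_smul, ev_mul_eq]
  rw [h2, map_sub, ev_derivRep, ev_derivRep, ev_coeff, ev_coeff, map_sub, map_add]
  abel

/-- At the pair (v, w) the left side is f((v w) ◁ X), and the two summands on the right are the two
terms of `ractU_mul`. -/
theorem comul_derivRep [FiniteDimensional K g₁] (X : g₁) (f : RepresentativeFunctions K g₂) :
    Coalgebra.comul (R := K) (M.derivRep X f) =
    TensorProduct.homTensorHomMap (RingHom.id K) _ _ _ _
      (TensorProduct.map M.actRep.toLinearMap (LinearMap.mul K (RepresentativeFunctions K g₂))
        ((ιLin K g₁).rTensor _ (M.coaction b X))) (Coalgebra.comul (R := K) f) +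
    (M.derivRep X).lTensor _ (Coalgebra.comul (R := K) f) := by
  refine ext_slice₂ fun v w => ?_
  rw [ev_comul, ev_derivRep, ractU_mul, ev_add, map_add, map_add]
  congr 1
  -- Evaluating the product X⟨1⟩ f₂ at w splits w by Δ, and X⟨0⟩ X⟨1⟩(w₁) is then w₁ ▷ X. The tensor
  -- n replaces the coaction of X so that pure tensors suffice.
  · have h1 : ∀ (n : g₁ ⊗[K] RepresentativeFunctions K g₂)
        (s : RepresentativeFunctions K g₂ ⊗[K] RepresentativeFunctions K g₂),
        ev w (slice v (TensorProduct.homTensorHomMap (RingHom.id K) _ _ _ _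
          (TensorProduct.map M.actRep.toLinearMap
            (LinearMap.mul K (RepresentativeFunctions K g₂)) ((ιLin K g₁).rTensor _ n)) s)) =
        ∑ i ∈ (Coalgebra.Repr.arbitrary K w).index,
          ev ((Coalgebra.Repr.arbitrary K w).right i) (slice (M.ractU v
            (TensorProduct.rid K g₁ ((ev ((Coalgebra.Repr.arbitrary K w).left i)).lTensor g₁ n)))
            s) := by
      intro n s
      induction s with
      | zero => simp
      | add s t hs ht => simp only [map_add, hs, ht, Finset.sum_add_distrib]
      | tmul p q =>
        induction n with
        | zero =>
          simp only [map_zero, LinearMap.zero_apply, slice_tmul]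
          simp [ev]
        | add m n hm hn =>
          simp only [map_add, LinearMap.add_apply, hm, hn, slice_tmul, ev_add, add_smul,
            Finset.sum_add_distrib]
        | tmul Y h =>
          have : M.actRep (ιLin K g₁ Y) = M.derivRep Y := M.actRep_ι Y
          simp only [LinearMap.rTensor_tmul, TensorProduct.map_tmul,
            TensorProduct.homTensorHomMap_apply, AlgHom.toLinearMap_apply, this, slice_tmul,
            LinearMap.mul_apply', ev_derivRep, map_smul, LinearMap.lTensor_tmul,
            TensorProduct.rid_tmul, ev_smul, smul_eq_mul, ev_mul (Coalgebra.Repr.arbitrary K w),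
            Finset.mul_sum]
          refine Finset.sum_congr rfl fun i _ => ?_
          ring
    rw [h1]
    simp only [rid_lTensor_ev_coaction, ev_comul]
    rw [← ev_sum]
    conv_lhs => rw [← (Coalgebra.Repr.arbitrary K w).eq, map_sum]
    rfl
  · have h2 : ∀ s : RepresentativeFunctions K g₂ ⊗[K] RepresentativeFunctions K g₂,
        ev w (slice v ((M.derivRep X).lTensor _ s)) = ev (M.ractU w X) (slice v s) := by
      intro s
      induction s with
      | zero => simp
      | add s t hs ht => simp only [map_add, hs, ht]
      | tmul p q => simp only [LinearMap.lTensor_tmul, slice_tmul, map_smul, ev_derivRep]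
    rw [h2, ev_comul]

/-- `R(g₂)` is a `g₁`-Hopf algebra. -/
theorem isLieHopf [FiniteDimensional K g₁] :
    IsLieHopf b (M.actRep.toLinearMap ∘ₗ ιLin K g₁) (M.coaction b) where
  mul_comm := FiniteDual.mul_comm
  act_lie X Y f := by
    change M.actRep (ι K ⁅X, Y⁆) f = M.actRep (ι K X) (M.actRep (ι K Y) f) -
      M.actRep (ι K Y) (M.actRep (ι K X) f)
    rw [LieHom.map_lie, LieRing.of_associative_ring_bracket, map_sub, map_mul, map_mul]
    rfl
  act_mul X f h := by
    change M.actRep (ι K X) (f * h) = M.actRep (ι K X) f * h + f * M.actRep (ι K X) h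
    rw [actRep_ι, derivRep_mul]
  coact_coassoc := M.coaction_coassoc b
  coact_counit X := by
    change TensorProduct.rid K g₁ ((ev 1).lTensor g₁ (M.coaction b X)) = X
    rw [rid_lTensor_ev_coaction, map_one, Module.End.one_apply]
  structure_identity i j k := by
    simp only [matrixCoeff_coaction]
    change M.actRep (ι K (b i)) _ - M.actRep (ι K (b j)) _ = _
    rw [actRep_ι, actRep_ι, structure_identity_coeff]
  comul_act X f := by
    change Coalgebra.comul (R := K) (M.actRep (ι K X) f) = _ +
      (M.actRep (ι K X)).lTensor _ _
    rw [actRep_ι, comul_derivRep M b, ← LinearMap.comp_apply (TensorProduct.map _ _),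
      LinearMap.map_comp_rTensor]
  counit_act X f := by
    change ev 1 (M.actRep (ι K X) f) = 0
    rw [actRep_ι, ev_derivRep, ractU_one]
    exact map_zero f.toLinearMap

end Actions

end LieMatchedPair

/-! ### Extension of the coaction of a g-Hopf algebra to U(g) -/

namespace IsLieHopf

open UniversalEnvelopingAlgebra

section Coaction

attribute [local instance 100] LieRing.ofAssociativeRing LieAlgebra.ofAssociativeAlgebra

variable {K : Type*} [Field K] {g F : Type*} [LieRing g] [LieAlgebra K g] [Ring F]
  [HopfAlgebra K F]

/-- `t ↦ (X⟨0⟩ ⊗ X⟨1⟩) t + (1 ⊗ X ▷) t` on `U(g) ⊗ F`; this is `∇(u) ↦ ∇(X u)`. -/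
noncomputable def coactStep (act : UniversalEnvelopingAlgebra K g →ₐ[K] Module.End K F)
    (coact : g →ₗ[K] g ⊗[K] F) :
    g →ₗ[K] Module.End K (UniversalEnvelopingAlgebra K g ⊗[K] F) :=
  LinearMap.mul K (UniversalEnvelopingAlgebra K g ⊗[K] F) ∘ₗ (ιLin K g).rTensor F ∘ₗ coact +
    LinearMap.lTensorHom _ ∘ₗ act.toLinearMap ∘ₗ ιLin K g

theorem coactStep_apply (act : UniversalEnvelopingAlgebra K g →ₐ[K] Module.End K F)
    (coact : g →ₗ[K] g ⊗[K] F) (X : g) (t : UniversalEnvelopingAlgebra K g ⊗[K] F) :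
    coactStep act coact X t = (ιLin K g).rTensor F (coact X) * t +
      (act (ι K X)).lTensor _ t := rfl

variable {κ : Type*} [Fintype κ] {b : Module.Basis κ K g}
  {act : UniversalEnvelopingAlgebra K g →ₐ[K] Module.End K F} {coact : g →ₗ[K] g ⊗[K] F}

theorem act_ι_mul (h : IsLieHopf b (act.toLinearMap ∘ₗ ιLin K g) coact) (X : g) (p q : F) :
    act (ι K X) (p * q) = act (ι K X) p * q + p * act (ι K X) q :=
  h.act_mul X p q

/-- The operator 1 ⊗ X ▷ touches only the factor F, where X is a derivation. This is what moves it
past left multiplications in `coactStep_lie`. -/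
theorem lTensor_act_ι_mul (h : IsLieHopf b (act.toLinearMap ∘ₗ ιLin K g) coact) (X : g)
    (s t : UniversalEnvelopingAlgebra K g ⊗[K] F) :
    (act (ι K X)).lTensor _ (s * t) =
      (act (ι K X)).lTensor _ s * t + s * (act (ι K X)).lTensor _ t := by
  induction s with
  | zero => simp
  | add x y hx hy => simp only [add_mul, map_add, hx, hy]; abel
  | tmul u p =>
    induction t with
    | zero => simp
    | add x y hx hy => simp only [mul_add, map_add, hx, hy]; abel
    | tmul w q =>
      simp only [Algebra.TensorProduct.tmul_mul_tmul, LinearMap.lTensor_tmul, h.act_ι_mul,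
        TensorProduct.tmul_add]

theorem coact_basis (b : Module.Basis κ K g) (coact : g →ₗ[K] g ⊗[K] F) (i : κ) :
    coact (b i) = ∑ j, b j ⊗ₜ[K] matrixCoeff b coact i j := by
  classical
  have : ∀ t : g ⊗[K] F,
      t = ∑ j, b j ⊗ₜ[K] TensorProduct.lid K F ((b.coord j).rTensor F t) := by
    intro t
    induction t with
    | zero => simp
    | add x y hx hy =>
      simp only [map_add, TensorProduct.tmul_add, Finset.sum_add_distrib]
      rw [← hx, ← hy]
    | tmul Y f =>
      conv_lhs => rw [← b.sum_repr Y, TensorProduct.sum_tmul]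
      simp [TensorProduct.smul_tmul]
  exact this _

/-- The structure identity without a basis, as a Maurer-Cartan equation for N(X) = X⟨0⟩ ⊗ X⟨1⟩ in
U(g) ⊗ F: [N(X), N(Y)] + X ▷ N(Y) - Y ▷ N(X) = N([X, Y]). -/
theorem structure_identity_tensor (h : IsLieHopf b (act.toLinearMap ∘ₗ ιLin K g) coact)
    (X Y : g) :
    (ιLin K g).rTensor F (coact X) * (ιLin K g).rTensor F (coact Y) -
      (ιLin K g).rTensor F (coact Y) * (ιLin K g).rTensor F (coact X) +
      (act (ι K X)).lTensor _ ((ιLin K g).rTensor F (coact Y)) -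
      (act (ι K Y)).lTensor _ ((ιLin K g).rTensor F (coact X)) =
    (ιLin K g).rTensor F (coact ⁅X, Y⁆) := by
  let N : g →ₗ[K] UniversalEnvelopingAlgebra K g ⊗[K] F := (ιLin K g).rTensor F ∘ₗ coact
  let m := LinearMap.mul K (UniversalEnvelopingAlgebra K g ⊗[K] F)
  let D : g →ₗ[K] Module.End K (UniversalEnvelopingAlgebra K g ⊗[K] F) :=
    LinearMap.lTensorHom _ ∘ₗ act.toLinearMap ∘ₗ ιLin K g
  -- Both sides are bilinear in X and Y, so basis vectors suffice.
  have key : m.compl₁₂ N N - (m.compl₁₂ N N).flip + D.compl₂ N - (D.compl₂ N).flip =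
      (LieModule.toEnd K g g).toLinearMap.compr₂ N := by
    refine LinearMap.ext_basis b b fun i j => ?_
    change N (b i) * N (b j) - N (b j) * N (b i) + (act (ι K (b i))).lTensor _ (N (b j)) -
      (act (ι K (b j))).lTensor _ (N (b i)) = N ⁅b i, b j⁆
    have hN : ∀ i, N (b i) = ∑ j, ι K (b j) ⊗ₜ[K] matrixCoeff b coact i j := by
      intro i
      change (ιLin K g).rTensor F (coact (b i)) = _
      rw [coact_basis b coact i, map_sum]
      rfl
    have hsi : ∀ k, act (ι K (b i)) (matrixCoeff b coact j k) =
        act (ι K (b j)) (matrixCoeff b coact i k) +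
        (∑ s, ∑ r, b.repr ⁅b s, b r⁆ k • (matrixCoeff b coact i r * matrixCoeff b coact j s) +
      ∑ l, b.repr ⁅b i, b j⁆ l • matrixCoeff b coact l k) := fun k =>
      eq_add_of_sub_eq' (h.structure_identity i j k)
    have hbr : N ⁅b i, b j⁆ =
        ∑ k, ι K (b k) ⊗ₜ[K] ∑ l, b.repr ⁅b i, b j⁆ l • matrixCoeff b coact l k := by
      conv_lhs => rw [← b.sum_repr ⁅b i, b j⁆]
      simp only [map_sum, map_smul, hN, TensorProduct.tmul_sum, Finset.smul_sum,
        TensorProduct.tmul_smul]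
      rw [Finset.sum_comm]
    have hcomm : N (b i) * N (b j) - N (b j) * N (b i) =
        -∑ k, ι K (b k) ⊗ₜ[K] ∑ s, ∑ r, b.repr ⁅b s, b r⁆ k •
          (matrixCoeff b coact i r * matrixCoeff b coact j s) := by
      have h1 : ∀ s r, ∑ k, ι K (b k) ⊗ₜ[K] (b.repr ⁅b s, b r⁆ k •
          (matrixCoeff b coact i r * matrixCoeff b coact j s)) =
          ι K ⁅b s, b r⁆ ⊗ₜ[K] (matrixCoeff b coact i r * matrixCoeff b coact j s) := by
        intro s r
        conv_rhs => rw [← b.sum_repr ⁅b s, b r⁆]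
        simp only [map_sum, map_smul, TensorProduct.sum_tmul, TensorProduct.tmul_smul,
          TensorProduct.smul_tmul']
      simp only [TensorProduct.tmul_sum]
      rw [Finset.sum_comm]
      conv_rhs => enter [1, 2, s]; rw [Finset.sum_comm]
      simp only [h1, hN, Finset.sum_mul_sum, Algebra.TensorProduct.tmul_mul_tmul]
      rw [Finset.sum_comm, ← Finset.sum_sub_distrib, ← Finset.sum_neg_distrib]
      refine Finset.sum_congr rfl fun s _ => ?_
      rw [← Finset.sum_sub_distrib, ← Finset.sum_neg_distrib]
      refine Finset.sum_congr rfl fun r _ => ?_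
      -- Commutativity of F gives both products of basis vectors the same coefficient f_i^r f_j^s,
      -- so that they combine into a commutator.
      rw [LieHom.map_lie, LieRing.of_associative_ring_bracket, TensorProduct.sub_tmul, neg_sub,
        h.mul_comm (matrixCoeff b coact j s)]
    rw [hcomm, hbr]
    simp only [hN, map_sum, LinearMap.lTensor_tmul, hsi, TensorProduct.tmul_add,
      Finset.sum_add_distrib]
    abel
  exact LinearMap.congr_fun₂ key X Y

/-- For operators of the form left multiplication by N(X) plus a derivation, the commutator is left
multiplication by the left side of the Maurer-Cartan equation plus the commutator of the
derivations. -/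
theorem coactStep_lie (h : IsLieHopf b (act.toLinearMap ∘ₗ ιLin K g) coact) (X Y : g) :
    coactStep act coact ⁅X, Y⁆ = ⁅coactStep act coact X, coactStep act coact Y⁆ := by
  refine LinearMap.ext fun t => ?_
  have h1 : (act (ι K ⁅X, Y⁆)).lTensor (UniversalEnvelopingAlgebra K g) t =
      (act (ι K X)).lTensor _ ((act (ι K Y)).lTensor _ t) -
        (act (ι K Y)).lTensor _ ((act (ι K X)).lTensor _ t) := by
    rw [LieHom.map_lie, LieRing.of_associative_ring_bracket, map_sub, map_mul, map_mul,
      LinearMap.lTensor_sub, LinearMap.lTensor_mul, LinearMap.lTensor_mul]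
    rfl
  rw [LieRing.of_associative_ring_bracket, LinearMap.sub_apply, Module.End.mul_apply,
    Module.End.mul_apply]
  simp only [coactStep_apply, h1, ← h.structure_identity_tensor X Y, map_add,
    h.lTensor_act_ι_mul]
  noncomm_ring

/-- The algebra homomorphism `u ↦ (∇(v) ↦ ∇(u v))`. -/
noncomputable def coactHom (h : IsLieHopf b (act.toLinearMap ∘ₗ ιLin K g) coact) :
    UniversalEnvelopingAlgebra K g →ₐ[K]
      Module.End K (UniversalEnvelopingAlgebra K g ⊗[K] F) :=
  lift K { coactStep act coact with map_lie' := fun {X Y} => h.coactStep_lie X Y }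

/-- The extension of the coaction of a `g`-Hopf algebra to `U(g)`. -/
noncomputable def coactU (h : IsLieHopf b (act.toLinearMap ∘ₗ ιLin K g) coact) :
    UniversalEnvelopingAlgebra K g →ₗ[K] UniversalEnvelopingAlgebra K g ⊗[K] F :=
  LinearMap.applyₗ 1 ∘ₗ h.coactHom.toLinearMap

theorem coactU_one (h : IsLieHopf b (act.toLinearMap ∘ₗ ιLin K g) coact) :
    h.coactU 1 = 1 := by
  simp [coactU]

theorem coactU_ι_mul (h : IsLieHopf b (act.toLinearMap ∘ₗ ιLin K g) coact) (X : g)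
    (u : UniversalEnvelopingAlgebra K g) :
    h.coactU (ι K X * u) = coactStep act coact X (h.coactU u) := by
  change h.coactHom (ι K X * u) 1 = _
  rw [map_mul, coactHom, lift_ι_apply]
  rfl

theorem act_ι_one (h : IsLieHopf b (act.toLinearMap ∘ₗ ιLin K g) coact) (X : g) :
    act (ι K X) 1 = 0 := by
  have := h.act_ι_mul X 1 1
  simpa [-ι_apply] using this

/-- One step applied to 1 ⊗ 1, where the derivation term vanishes because X ▷ 1 = 0. -/
theorem coactU_ι (h : IsLieHopf b (act.toLinearMap ∘ₗ ιLin K g) coact) (X : g) :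
    h.coactU (ι K X) = (ιLin K g).rTensor F (coact X) := by
  have := h.coactU_ι_mul X 1
  rwa [mul_one, coactU_one, coactStep_apply, mul_one, Algebra.TensorProduct.one_def,
    LinearMap.lTensor_tmul, act_ι_one h, TensorProduct.tmul_zero, add_zero] at this

end Coaction

end IsLieHopf

/-! ### The operators behind the formulas for Δ(u ▷ f) and ∇(u v) -/

namespace IsLieHopf

open UniversalEnvelopingAlgebra

section Coaction

attribute [local instance 100] LieRing.ofAssociativeRing LieAlgebra.ofAssociativeAlgebra

variable {K : Type*} [Field K] {g F : Type*} [LieRing g] [LieAlgebra K g] [Ring F]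
  [HopfAlgebra K F]
variable {κ : Type*} [Fintype κ] {b : Module.Basis κ K g}
  {act : UniversalEnvelopingAlgebra K g →ₐ[K] Module.End K F} {coact : g →ₗ[K] g ⊗[K] F}

/-- The operator `p ⊗ f ↦ u₁⟨0⟩ ▷ p ⊗ u₁⟨1⟩ (u₂ ▷ f)` on `P ⊗ F`, for a `U(g)`-module `P`. -/
noncomputable def crossed (h : IsLieHopf b (act.toLinearMap ∘ₗ ιLin K g) coact)
    {P : Type*} [AddCommGroup P] [Module K P]
    (ρ : UniversalEnvelopingAlgebra K g →ₗ[K] Module.End K P)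
    (u : UniversalEnvelopingAlgebra K g) : Module.End K (P ⊗[K] F) :=
  TensorProduct.homTensorHomMap (RingHom.id K) P F P F
    (TensorProduct.map ρ (mulAct act) (coactFst h.coactU u))

theorem crossed_add (h : IsLieHopf b (act.toLinearMap ∘ₗ ιLin K g) coact)
    {P : Type*} [AddCommGroup P] [Module K P]
    (ρ : UniversalEnvelopingAlgebra K g →ₗ[K] Module.End K P)
    (u v : UniversalEnvelopingAlgebra K g) :
    h.crossed ρ (u + v) = h.crossed ρ u + h.crossed ρ v := by
  simp only [crossed, map_add]

theorem crossed_smul (h : IsLieHopf b (act.toLinearMap ∘ₗ ιLin K g) coact)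
    {P : Type*} [AddCommGroup P] [Module K P]
    (ρ : UniversalEnvelopingAlgebra K g →ₗ[K] Module.End K P) (c : K)
    (u : UniversalEnvelopingAlgebra K g) :
    h.crossed ρ (c • u) = c • h.crossed ρ u := by
  simp only [crossed, map_smul]

theorem crossed_one (h : IsLieHopf b (act.toLinearMap ∘ₗ ιLin K g) coact)
    {P : Type*} [AddCommGroup P] [Module K P]
    (ρ : UniversalEnvelopingAlgebra K g →ₗ[K] Module.End K P) (hρ : ρ 1 = 1) :
    h.crossed ρ 1 = 1 := by
  refine TensorProduct.ext' fun p f => ?_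
  simp [crossed, coactFst, mulAct, Bialgebra.comul_one, Algebra.TensorProduct.one_def, hρ,
    coactU_one]

/-- The first factor on the right is the crossed operator of X written out, so this is
multiplicativity of u ↦ `h.crossed ρ u` for a generator on the left. It serves P = F for Δ(u ▷ f)
and P = U(g) for ∇(u v). -/
theorem crossed_ι_mul (h : IsLieHopf b (act.toLinearMap ∘ₗ ιLin K g) coact)
    {P : Type*} [AddCommGroup P] [Module K P]
    (ρ : UniversalEnvelopingAlgebra K g →ₗ[K] Module.End K P)
    (hρ : ∀ u v, ρ (u * v) = ρ u * ρ v) (X : g)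
    (u : UniversalEnvelopingAlgebra K g) :
    h.crossed ρ (ι K X * u) =
      (TensorProduct.homTensorHomMap (RingHom.id K) P F P F
        (TensorProduct.map (ρ ∘ₗ ιLin K g) (LinearMap.mul K F) (coact X)) +
          (act (ι K X)).lTensor P) * h.crossed ρ u := by
  have tm : ∀ (a : UniversalEnvelopingAlgebra K g) (f : F) (w : UniversalEnvelopingAlgebra K g)
      (p : P) (q : F), TensorProduct.homTensorHomMap (RingHom.id K) P F P F
        (TensorProduct.map ρ (mulAct act) (TensorProduct.assoc K _ _ _ ((a ⊗ₜ f) ⊗ₜ w)))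
          (p ⊗ₜ q) = ρ a p ⊗ₜ (f * act w q) := fun _ _ _ _ _ => rfl
  have key : ∀ (n : g ⊗[K] F) (s : UniversalEnvelopingAlgebra K g ⊗[K] F)
      (w : UniversalEnvelopingAlgebra K g),
      TensorProduct.homTensorHomMap (RingHom.id K) P F P F
        (TensorProduct.map ρ (mulAct act) (TensorProduct.assoc K _ _ _
          (((ιLin K g).rTensor F n * s + (act (ι K X)).lTensor _ s) ⊗ₜ w +
            s ⊗ₜ (ι K X * w)))) =
      (TensorProduct.homTensorHomMap (RingHom.id K) P F P F
        (TensorProduct.map (ρ ∘ₗ ιLin K g) (LinearMap.mul K F) n) +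
          (act (ι K X)).lTensor P) *
        TensorProduct.homTensorHomMap (RingHom.id K) P F P F
          (TensorProduct.map ρ (mulAct act) (TensorProduct.assoc K _ _ _ (s ⊗ₜ w))) := by
    intro n s w
    induction s with
    | zero => simp
    | add s t hs ht =>
      simp only [mul_add, map_add, TensorProduct.add_tmul] at hs ht ⊢
      rw [← hs, ← ht]
      abel
    | tmul a f =>
      have h1 : TensorProduct.homTensorHomMap (RingHom.id K) P F P F
          (TensorProduct.map ρ (mulAct act) (TensorProduct.assoc K _ _ _
          (((ιLin K g).rTensor F n * a ⊗ₜ f) ⊗ₜ w))) =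
          TensorProduct.homTensorHomMap (RingHom.id K) P F P F
            (TensorProduct.map (ρ ∘ₗ ιLin K g) (LinearMap.mul K F) n) *
          TensorProduct.homTensorHomMap (RingHom.id K) P F P F
            (TensorProduct.map ρ (mulAct act) (TensorProduct.assoc K _ _ _
              ((a ⊗ₜ f) ⊗ₜ w))) := by
        induction n with
        | zero => simp
        | add s t hs ht => simp only [add_mul, map_add, TensorProduct.add_tmul, hs, ht]
        | tmul Y e =>
          refine TensorProduct.ext' fun p q => ?_
          rw [LinearMap.rTensor_tmul, Algebra.TensorProduct.tmul_mul_tmul, tm,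
            Module.End.mul_apply, tm, hρ, mul_assoc]
          rfl
      rw [TensorProduct.add_tmul, map_add, map_add, map_add, map_add, map_add, map_add, h1,
        add_mul, add_assoc]
      congr 1
      -- What remains is the Leibniz rule (X ▷ f)(w ▷ q) + f (X w ▷ q) = X ▷ (f (w ▷ q)).
      refine TensorProduct.ext' fun p q => ?_
      rw [LinearMap.lTensor_tmul, LinearMap.add_apply, tm, tm, Module.End.mul_apply, tm,
        LinearMap.lTensor_tmul, h.act_ι_mul, TensorProduct.tmul_add, map_mul]
      rfl
  unfold crossed
  simp only [coactFst, LinearMap.comp_apply, LinearEquiv.coe_coe, Bialgebra.comul_mul, comul_ι]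
  generalize Coalgebra.comul (R := K) u = t
  induction t with
  | zero => simp
  | add s t hs ht => simp only [mul_add, map_add] at hs ht ⊢; rw [hs, ht]
  | tmul a w =>
    rw [LinearMap.rTensor_tmul, ← key, add_mul, Algebra.TensorProduct.tmul_mul_tmul,
      Algebra.TensorProduct.tmul_mul_tmul, one_mul, one_mul, map_add, LinearMap.rTensor_tmul,
      LinearMap.rTensor_tmul, coactU_ι_mul, coactStep_apply]

/-! ### Uniqueness, coassociativity and counits of the coaction -/

/-- The recursion that determines the coaction of a matched pair on `U(g)`. -/
theorem coact_ι_mul_of_isHopfMatchedPair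
    {c : UniversalEnvelopingAlgebra K g →ₗ[K] UniversalEnvelopingAlgebra K g ⊗[K] F}
    (hc : IsHopfMatchedPair act c)
    (hX : ∀ X, c (ιLin K g X) = (ιLin K g).rTensor F (coact X)) (X : g)
    (u : UniversalEnvelopingAlgebra K g) :
    c (ι K X * u) = coactStep act coact X (c u) := by
  have h1 : c (ι K X) = (ιLin K g).rTensor F (coact X) := hX X
  -- As X is primitive and ∇(1) = 1 ⊗ 1, the product rule for X u has just two terms, from X⟨0⟩ ⊗
  -- X⟨1⟩ ⊗ 1 and from 1 ⊗ 1 ⊗ X.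
  rw [hc.coact_mul, coactStep_apply, coactFst, LinearMap.comp_apply, LinearMap.comp_apply,
    comul_ι, map_add, LinearMap.rTensor_tmul, LinearMap.rTensor_tmul, hc.coact_one, h1]
  generalize c u = s
  rw [map_add, map_add, map_add, LinearMap.add_apply]
  congr 1
  · generalize coact X = n
    induction s with
    | zero => simp
    | add s t hs ht => simp only [mul_add, map_add, hs, ht]
    | tmul a f =>
      induction n with
      | zero => simp
      | add s t hs ht =>
        simp only [add_mul, map_add, TensorProduct.add_tmul, LinearMap.add_apply, hs, ht]
      | tmul Y e => simp [mulAct]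
  · induction s with
    | zero => simp
    | add s t hs ht => simp only [map_add, hs, ht]
    | tmul a f => simp [mulAct, -ι_apply]

/-- Of the matched pair axioms only those for ∇(1) and ∇(u v) enter: they fix the start and each
step of the left induction. -/
theorem coactU_unique (h : IsLieHopf b (act.toLinearMap ∘ₗ ιLin K g) coact)
    {c : UniversalEnvelopingAlgebra K g →ₗ[K] UniversalEnvelopingAlgebra K g ⊗[K] F}
    (hc : IsHopfMatchedPair act c)
    (hX : ∀ X, c (ιLin K g X) = (ιLin K g).rTensor F (coact X)) : c = h.coactU := by
  refine LinearMap.ext fun u => ?_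
  induction u using induction_left with
  | one => rw [hc.coact_one, coactU_one, Algebra.TensorProduct.one_def]
  | add u v hu hv => rw [map_add, map_add, hu, hv]
  | smul r u hu => rw [map_smul, map_smul, hu]
  | mul X u hu => rw [coact_ι_mul_of_isHopfMatchedPair hc hX, coactU_ι_mul, hu]

/-- When u becomes X u, both sides are multiplied by the coassociated coaction of X, and to this is
added the effect on F ⊗ F of the operator that describes Δ(X ▷ f). On the left the part X⟨0⟩ ▷ ⊗
X⟨1⟩ of that operator comes from ∇(X⟨0⟩ a); on the right it comes from Δ. -/
theorem coactU_coassoc (h : IsLieHopf b (act.toLinearMap ∘ₗ ιLin K g) coact)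
    (u : UniversalEnvelopingAlgebra K g) :
    TensorProduct.assoc K _ F F (h.coactU.rTensor F (h.coactU u)) =
      (Coalgebra.comul (R := K) (A := F)).lTensor _ (h.coactU u) := by
  induction u using induction_left with
  | one =>
    simp [coactU_one, Algebra.TensorProduct.one_def, Bialgebra.comul_one]
  | add u v hu hv => simp only [map_add, hu, hv]
  | smul r u hu => simp only [map_smul, hu]
  | mul X u hu =>
    have h1 : ∀ (n : g ⊗[K] F) (s : UniversalEnvelopingAlgebra K g ⊗[K] F),
        TensorProduct.assoc K _ F F (h.coactU.rTensor F ((ιLin K g).rTensor F n * s)) =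
          (ιLin K g).rTensor _ (TensorProduct.assoc K g F F (coact.rTensor F n)) *
            TensorProduct.assoc K _ F F (h.coactU.rTensor F s) +
          (TensorProduct.homTensorHomMap (RingHom.id K) F F F F
            (TensorProduct.map (act.toLinearMap ∘ₗ ιLin K g) (LinearMap.mul K F) n)).lTensor _
              (TensorProduct.assoc K _ F F (h.coactU.rTensor F s)) := by
      intro n s
      induction s with
      | zero => simp
      | add s t hs ht => simp only [mul_add, map_add, hs, ht]; abel
      | tmul a f =>
        induction n with
        | zero => simp
        | add s t hs ht =>
          simp only [add_mul, map_add, hs, ht, LinearMap.lTensor_add, LinearMap.add_apply]; abel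
        | tmul Y e =>
          have : h.coactU (ιLin K g Y * a) = coactStep act coact Y (h.coactU a) :=
            h.coactU_ι_mul Y a
          rw [LinearMap.rTensor_tmul, Algebra.TensorProduct.tmul_mul_tmul,
            LinearMap.rTensor_tmul, this, coactStep_apply, LinearMap.rTensor_tmul,
            LinearMap.rTensor_tmul, TensorProduct.add_tmul, map_add]
          generalize h.coactU a = s
          congr 1
          · generalize coact Y = n
            induction s with
            | zero => simp
            | add s t hs ht => simp only [mul_add, map_add, TensorProduct.add_tmul, hs, ht]
            | tmul a' f' =>
              induction n with
              | zero => simp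
              | add s t hs ht => simp only [add_mul, map_add, TensorProduct.add_tmul, hs, ht]
              | tmul Z e' => simp
          · induction s with
            | zero => simp
            | add s t hs ht => simp only [map_add, TensorProduct.add_tmul, hs, ht]
            | tmul a' f' => rfl
    have h2 : ∀ s : UniversalEnvelopingAlgebra K g ⊗[K] F,
        TensorProduct.assoc K _ F F (h.coactU.rTensor F ((act (ι K X)).lTensor _ s)) =
          ((act (ι K X)).lTensor F).lTensor _
            (TensorProduct.assoc K _ F F (h.coactU.rTensor F s)) := by
      intro s
      induction s with
      | zero => simp
      | add s t hs ht => simp only [map_add, hs, ht]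
      | tmul a f =>
        simp only [LinearMap.rTensor_tmul, LinearMap.lTensor_tmul]
        generalize h.coactU a = s
        induction s with
        | zero => simp
        | add s t hs ht => simp only [map_add, TensorProduct.add_tmul, hs, ht]
        | tmul a' f' => rfl
    have h3 : ∀ (n : g ⊗[K] F) (s : UniversalEnvelopingAlgebra K g ⊗[K] F),
        (Coalgebra.comul (R := K) (A := F)).lTensor _ ((ιLin K g).rTensor F n * s) =
          (ιLin K g).rTensor _ ((Coalgebra.comul (R := K) (A := F)).lTensor g n) *
          (Coalgebra.comul (R := K) (A := F)).lTensor _ s := by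
      intro n s
      induction s with
      | zero => simp
      | add s t hs ht => simp only [mul_add, map_add, hs, ht]
      | tmul a f =>
        induction n with
        | zero => simp
        | add s t hs ht => simp only [add_mul, map_add, hs, ht]
        | tmul Y e => simp [Bialgebra.comul_mul]
    -- Here the g-Hopf axiom for Δ(X ▷ f) enters; coassociativity on g then matches the remaining
    -- multiplication terms.
    have h4 : ∀ s : UniversalEnvelopingAlgebra K g ⊗[K] F,
        (Coalgebra.comul (R := K) (A := F)).lTensor _ ((act (ι K X)).lTensor _ s) =
        (TensorProduct.homTensorHomMap (RingHom.id K) F F F F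
            (TensorProduct.map (act.toLinearMap ∘ₗ ιLin K g) (LinearMap.mul K F)
              (coact X))).lTensor _ ((Coalgebra.comul (R := K) (A := F)).lTensor _ s) +
        ((act (ι K X)).lTensor F).lTensor _ ((Coalgebra.comul (R := K) (A := F)).lTensor _ s) := by
      intro s
      induction s with
      | zero => simp
      | add s t hs ht => simp only [map_add, hs, ht]; abel
      | tmul a f =>
        have : Coalgebra.comul (R := K) (act (ι K X) f) = _ := h.comul_act X f
        rw [LinearMap.lTensor_tmul, LinearMap.lTensor_tmul, LinearMap.lTensor_tmul, this,
          TensorProduct.tmul_add]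
        rfl
    rw [coactU_ι_mul, coactStep_apply, map_add, map_add, map_add, h1, h2, h3, h4,
      h.coact_coassoc, hu]
    abel

/-- The counit of F is multiplicative and kills X ▷ f, so only left multiplication by X⟨0⟩ ε(X⟨1⟩) =
X survives a step. -/
theorem coactU_counit (h : IsLieHopf b (act.toLinearMap ∘ₗ ιLin K g) coact)
    (u : UniversalEnvelopingAlgebra K g) :
    TensorProduct.rid K _ ((Coalgebra.counit (R := K) (A := F)).lTensor _ (h.coactU u)) = u := by
  induction u using induction_left with
  | one => simp [coactU_one, Algebra.TensorProduct.one_def]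
  | add u v hu hv => simp only [map_add, hu, hv]
  | smul r u hu => simp only [map_smul, hu]
  | mul X u hu =>
    have h1 : ∀ (n : g ⊗[K] F) (s : UniversalEnvelopingAlgebra K g ⊗[K] F),
        TensorProduct.rid K _ ((Coalgebra.counit (R := K) (A := F)).lTensor _
          ((ιLin K g).rTensor F n * s)) =
        ιLin K g (TensorProduct.rid K _ ((Coalgebra.counit (R := K) (A := F)).lTensor g n)) *
        TensorProduct.rid K _ ((Coalgebra.counit (R := K) (A := F)).lTensor _ s) := by
      intro n s
      induction s with
      | zero => simp
      | add s t hs ht => simp only [mul_add, map_add, hs, ht]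
      | tmul a f =>
        induction n with
        | zero => simp
        | add s t hs ht => simp only [add_mul, map_add, hs, ht]
        | tmul Y e => simp [smul_smul, _root_.mul_comm]
    have h2 : ∀ s : UniversalEnvelopingAlgebra K g ⊗[K] F,
        (Coalgebra.counit (R := K) (A := F)).lTensor _ ((act (ι K X)).lTensor _ s) = 0 := by
      intro s
      induction s with
      | zero => simp
      | add s t hs ht => simp only [map_add, hs, ht, add_zero]
      | tmul a f =>
        have : Coalgebra.counit (R := K) (act (ι K X) f) = 0 := h.counit_act X f
        simp [this, -ι_apply]
    rw [coactU_ι_mul, coactStep_apply, map_add, map_add, h1, h2, h.coact_counit, hu, map_zero,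
      add_zero]
    rfl

/-- Both terms of a step vanish: the first because ε is zero on g, the second because X ▷ 1 = 0. -/
theorem counit_coactU (h : IsLieHopf b (act.toLinearMap ∘ₗ ιLin K g) coact)
    (u : UniversalEnvelopingAlgebra K g) :
    TensorProduct.lid K F ((Coalgebra.counit (R := K)
      (A := UniversalEnvelopingAlgebra K g)).rTensor F (h.coactU u)) =
      Coalgebra.counit (R := K) u • (1 : F) := by
  induction u using induction_left with
  | one => simp [coactU_one, Algebra.TensorProduct.one_def]
  | add u v hu hv => simp only [map_add, hu, hv, add_smul]
  | smul r u hu => simp only [map_smul, hu, smul_assoc]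
  | mul X u hu =>
    have h1 : ∀ (n : g ⊗[K] F) (s : UniversalEnvelopingAlgebra K g ⊗[K] F),
        (Coalgebra.counit (R := K) (A := UniversalEnvelopingAlgebra K g)).rTensor F
          ((ιLin K g).rTensor F n * s) = 0 := by
      intro n s
      induction s with
      | zero => simp
      | add s t hs ht => simp only [mul_add, map_add, hs, ht, add_zero]
      | tmul a f =>
        induction n with
        | zero => simp
        | add s t hs ht => simp only [add_mul, map_add, hs, ht, add_zero]
        | tmul Y e =>
          have : Coalgebra.counit (R := K) (ιLin K g Y) = 0 := counit_ι Y
          simp [this]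
    have h2 : ∀ s : UniversalEnvelopingAlgebra K g ⊗[K] F,
        TensorProduct.lid K F ((Coalgebra.counit (R := K)
          (A := UniversalEnvelopingAlgebra K g)).rTensor F ((act (ι K X)).lTensor _ s)) =
        act (ι K X) (TensorProduct.lid K F ((Coalgebra.counit (R := K)
          (A := UniversalEnvelopingAlgebra K g)).rTensor F s)) := by
      intro s
      induction s with
      | zero => simp
      | add s t hs ht => simp only [map_add, hs, ht]
      | tmul a f => simp [-ι_apply]
    rw [coactU_ι_mul, coactStep_apply, map_add, map_add, h1, h2, hu, map_zero, zero_add,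
      map_smul, h.act_ι_one, Bialgebra.counit_mul, counit_ι, zero_mul, zero_smul, smul_zero]

/-! ### Comodule coalgebra property and exchange axiom -/

theorem comul_ιLin (Y : g) :
    Coalgebra.comul (R := K) (ιLin K g Y) = ιLin K g Y ⊗ₜ[K] 1 + 1 ⊗ₜ[K] ιLin K g Y :=
  comul_ι Y

theorem rTensor_comul_mul (n : g ⊗[K] F) (s : UniversalEnvelopingAlgebra K g ⊗[K] F) :
    (Coalgebra.comul (R := K) (A := UniversalEnvelopingAlgebra K g)).rTensor F
      ((ιLin K g).rTensor F n * s) =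
    (Coalgebra.comul (R := K) ∘ₗ ιLin K g).rTensor F n *
      (Coalgebra.comul (R := K) (A := UniversalEnvelopingAlgebra K g)).rTensor F s := by
  induction s with
  | zero => simp
  | add s t hs ht => simp only [mul_add, map_add, hs, ht]
  | tmul a f =>
    induction n with
    | zero => simp
    | add s t hs ht => simp only [add_mul, map_add, hs, ht]
    | tmul Y e =>
      simp only [LinearMap.rTensor_tmul, Algebra.TensorProduct.tmul_mul_tmul,
        Bialgebra.comul_mul]
      rfl

/-- The two summands mirror the terms X u₁ ⊗ u₂ and u₁ ⊗ X u₂ of Δ(X u). They combine because X⟨0⟩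
is primitive, once commutativity of F has moved X⟨1⟩ to the front. -/
theorem mul_interchange_mul (h : IsLieHopf b (act.toLinearMap ∘ₗ ιLin K g) coact)
    (n : g ⊗[K] F) (s t : UniversalEnvelopingAlgebra K g ⊗[K] F) :
    (LinearMap.mul' K F).lTensor _ (TensorProduct.tensorTensorTensorComm K _ F _ F
      (((ιLin K g).rTensor F n * s) ⊗ₜ t + s ⊗ₜ ((ιLin K g).rTensor F n * t))) =
    (Coalgebra.comul (R := K) ∘ₗ ιLin K g).rTensor F n * (LinearMap.mul' K F).lTensor _
      (TensorProduct.tensorTensorTensorComm K _ F _ F (s ⊗ₜ t)) := by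
  induction s with
  | zero => simp
  | add x y hx hy =>
    simp only [mul_add, map_add, TensorProduct.add_tmul] at hx hy ⊢
    rw [← hx, ← hy]; abel
  | tmul a f =>
    induction t with
    | zero => simp
    | add x y hx hy =>
      simp only [mul_add, map_add, TensorProduct.tmul_add] at hx hy ⊢
      rw [← hx, ← hy]; abel
    | tmul a' f' =>
      induction n with
      | zero => simp
      | add x y hx hy =>
        simp only [add_mul, map_add, TensorProduct.tmul_add, TensorProduct.add_tmul]
          at hx hy ⊢
        rw [← hx, ← hy]; abel
      | tmul Y e =>
        simp only [LinearMap.rTensor_tmul, Algebra.TensorProduct.tmul_mul_tmul, map_add,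
          TensorProduct.tensorTensorTensorComm_tmul, LinearMap.lTensor_tmul,
          LinearMap.mul'_apply, LinearMap.comp_apply, comul_ιLin, add_mul, one_mul,
          TensorProduct.add_tmul]
        rw [← mul_assoc f e f', h.mul_comm f e, mul_assoc]

/-- The counterpart for the derivation term of a step: the Leibniz rule on F. -/
theorem mul_interchange_act (h : IsLieHopf b (act.toLinearMap ∘ₗ ιLin K g) coact) (X : g)
    (s t : UniversalEnvelopingAlgebra K g ⊗[K] F) :
    (LinearMap.mul' K F).lTensor _ (TensorProduct.tensorTensorTensorComm K _ F _ F
      (((act (ι K X)).lTensor _ s) ⊗ₜ t + s ⊗ₜ ((act (ι K X)).lTensor _ t))) =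
    (act (ι K X)).lTensor _ ((LinearMap.mul' K F).lTensor _
      (TensorProduct.tensorTensorTensorComm K _ F _ F (s ⊗ₜ t))) := by
  induction s with
  | zero => simp
  | add x y hx hy =>
    simp only [map_add, TensorProduct.add_tmul] at hx hy ⊢
    rw [← hx, ← hy]; abel
  | tmul a f =>
    induction t with
    | zero => simp
    | add x y hx hy =>
      simp only [map_add, TensorProduct.tmul_add] at hx hy ⊢
      rw [← hx, ← hy]; abel
    | tmul a' f' =>
      simp only [map_add, TensorProduct.tensorTensorTensorComm_tmul,
        LinearMap.lTensor_tmul, LinearMap.mul'_apply, h.act_ι_mul, TensorProduct.tmul_add]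

/-- Both sides obey the recursion T ↦ (Δ(X⟨0⟩) ⊗ X⟨1⟩) T + (1 ⊗ 1 ⊗ X ▷) T; for the right side this
is the sum of the two interchange lemmas. -/
theorem comul_coactU (h : IsLieHopf b (act.toLinearMap ∘ₗ ιLin K g) coact)
    (u : UniversalEnvelopingAlgebra K g) :
    (Coalgebra.comul (R := K) (A := UniversalEnvelopingAlgebra K g)).rTensor F (h.coactU u) =
    (LinearMap.mul' K F).lTensor _ (TensorProduct.tensorTensorTensorComm K _ F _ F
      (TensorProduct.map h.coactU h.coactU (Coalgebra.comul (R := K) u))) := by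
  induction u using induction_left with
  | one => simp [coactU_one, Algebra.TensorProduct.one_def, Bialgebra.comul_one]
  | add u v hu hv => simp only [map_add, hu, hv]
  | smul r u hu => simp only [map_smul, hu]
  | mul X u hu =>
    have h2 : ∀ s : UniversalEnvelopingAlgebra K g ⊗[K] F,
        (Coalgebra.comul (R := K) (A := UniversalEnvelopingAlgebra K g)).rTensor F
          ((act (ι K X)).lTensor _ s) = (act (ι K X)).lTensor _
        ((Coalgebra.comul (R := K) (A := UniversalEnvelopingAlgebra K g)).rTensor F s) := by
      intro s
      induction s with
      | zero => simp
      | add s t hs ht => simp only [map_add, hs, ht]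
      | tmul a f => rfl
    rw [coactU_ι_mul, coactStep_apply, map_add, rTensor_comul_mul, h2, hu,
      Bialgebra.comul_mul, comul_ι]
    generalize Coalgebra.comul (R := K) u = t
    induction t with
    | zero => simp
    | add x y hx hy =>
      rw [map_add, map_add, map_add, mul_add, map_add, mul_add, map_add, map_add, map_add, ← hx,
        ← hy, add_add_add_comm]
    | tmul a a' =>
      rw [TensorProduct.map_tmul, ← h.mul_interchange_mul,
        ← h.mul_interchange_act, ← map_add, ← map_add, add_mul,
        Algebra.TensorProduct.tmul_mul_tmul, Algebra.TensorProduct.tmul_mul_tmul, one_mul,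
        one_mul, map_add (TensorProduct.map h.coactU h.coactU), TensorProduct.map_tmul,
        TensorProduct.map_tmul, coactU_ι_mul,
        coactU_ι_mul, coactStep_apply, coactStep_apply, TensorProduct.add_tmul,
        TensorProduct.tmul_add, add_add_add_comm]

theorem act_coactU (h : IsLieHopf b (act.toLinearMap ∘ₗ ιLin K g) coact)
    (u : UniversalEnvelopingAlgebra K g) (f : F) :
    (LinearMap.mul' K F).lTensor _ (TensorProduct.leftComm K F _ F
      (TensorProduct.map (act.toLinearMap.flip f) h.coactU (Coalgebra.comul (R := K) u))) =
    (LinearMap.applyₗ f ∘ₗ mulAct act).lTensor _ (coactFst h.coactU u) := by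
  have h1 : ∀ s : UniversalEnvelopingAlgebra K g ⊗[K] F, ∀ p : F,
      (LinearMap.mul' K F).lTensor _ (TensorProduct.leftComm K F _ F (p ⊗ₜ s)) =
      (LinearMap.mulLeft K p).lTensor _ s := by
    intro s p
    induction s with
    | zero => simp
    | add x y hx hy => simp only [map_add, TensorProduct.tmul_add, hx, hy]
    | tmul a q => rfl
  have h2 : ∀ (s : UniversalEnvelopingAlgebra K g ⊗[K] F) (w : UniversalEnvelopingAlgebra K g),
      (LinearMap.applyₗ f ∘ₗ mulAct act).lTensor _ (TensorProduct.assoc K _ F _ (s ⊗ₜ w)) =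
      (LinearMap.mulLeft K (act w f)).lTensor _ s := by
    intro s w
    induction s with
    | zero => simp
    | add x y hx hy => simp only [map_add, TensorProduct.add_tmul, hx, hy]
    | tmul a q =>
      rw [LinearMap.lTensor_tmul, LinearMap.mulLeft_apply, h.mul_comm]
      rfl
  rw [coactFst, LinearMap.comp_apply, LinearMap.comp_apply]
  -- Cocommutativity exchanges u₁ and u₂ on the left; the sides then differ only in the order of a
  -- product in F, which `h2` has already reversed.
  conv_lhs => rw [← Coalgebra.comm_comul K u]
  generalize Coalgebra.comul (R := K) u = t
  induction t with
  | zero => simp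
  | add x y hx hy => simp only [map_add, hx, hy]
  | tmul a w =>
    rw [TensorProduct.comm_tmul, TensorProduct.map_tmul, h1, LinearMap.rTensor_tmul,
      LinearEquiv.coe_coe, h2]
    rfl

/-! ### The matched pair of Hopf algebras -/

/-- A commutative `g`-Hopf algebra `F` gives a matched pair of Hopf algebras `(U(g), F)`. -/
theorem isHopfMatchedPair (h : IsLieHopf b (act.toLinearMap ∘ₗ ιLin K g) coact) :
    IsHopfMatchedPair act h.coactU where
  coact_coassoc := h.coactU_coassoc
  coact_counit := h.coactU_counit
  comul_coact := h.comul_coactU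
  counit_coact := h.counit_coactU
  act_one u := by
    induction u using induction_left with
    | one => simp
    | add u v hu hv => simp only [map_add, LinearMap.add_apply, hu, hv, add_smul]
    | smul r u hu => simp only [map_smul, LinearMap.smul_apply, hu, smul_assoc]
    | mul X u hu =>
      rw [map_mul, Module.End.mul_apply, hu, map_smul, h.act_ι_one, Bialgebra.counit_mul,
        counit_ι, zero_mul, zero_smul, smul_zero]
  act_mul u p q := by
    induction u using induction_left with
    | one => simp [Bialgebra.comul_one, Algebra.TensorProduct.one_def]
    | add u v hu hv => simp only [map_add, LinearMap.add_apply, hu, hv]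
    | smul r u hu => simp only [map_smul, LinearMap.smul_apply, hu]
    | mul X u hu =>
      rw [map_mul act, Module.End.mul_apply, hu, Bialgebra.comul_mul, comul_ι]
      generalize Coalgebra.comul (R := K) u = t
      induction t with
      | zero => simp
      | add x y hx hy => simp only [mul_add, map_add, LinearMap.add_apply, hx, hy]
      | tmul a w =>
        simp only [add_mul, Algebra.TensorProduct.tmul_mul_tmul, one_mul, map_add,
          TensorProduct.map_tmul, TensorProduct.homTensorHomMap_apply, LinearMap.add_apply,
          LinearMap.mul'_apply, AlgHom.toLinearMap_apply, map_mul, Module.End.mul_apply,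
          h.act_ι_mul]
  counit_act u f := by
    induction u using induction_left with
    | one => simp
    | add u v hu hv => simp only [map_add, LinearMap.add_apply, hu, hv, add_mul]
    | smul r u hu =>
      simp only [map_smul, LinearMap.smul_apply, hu, smul_eq_mul, mul_assoc]
    | mul X u hu =>
      have : ∀ p, Coalgebra.counit (R := K) (act (ι K X) p) = 0 := h.counit_act X
      rw [map_mul, Module.End.mul_apply, this, Bialgebra.counit_mul, counit_ι, zero_mul,
        zero_mul]
  comul_act u f := by
    -- For P = F, the crossed operator of X is the one by which the g-Hopf axiom expresses Δ(X ▷ f),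
    -- so each step of the induction composes with it.
    change _ = h.crossed act.toLinearMap u (Coalgebra.comul (R := K) f)
    induction u using induction_left with
    | one => rw [h.crossed_one _ (map_one act), map_one]; rfl
    | add u v hu hv => simp only [map_add, LinearMap.add_apply, hu, hv, crossed_add]
    | smul r u hu => simp only [map_smul, LinearMap.smul_apply, hu, crossed_smul]
    | mul X u hu =>
      have : ∀ p, Coalgebra.comul (R := K) (act (ι K X) p) = _ := h.comul_act X
      rw [map_mul, Module.End.mul_apply, this, hu, h.crossed_ι_mul _ (map_mul act),
        Module.End.mul_apply]
      rfl
  coact_one := h.coactU_one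
  coact_mul u v := by
    -- For P = U(g) with left multiplication, the crossed operator of X is `coactStep act coact X`.
    change _ = h.crossed (LinearMap.mul K (UniversalEnvelopingAlgebra K g)) u (h.coactU v)
    have hm : ∀ x y, LinearMap.mul K (UniversalEnvelopingAlgebra K g) (x * y) =
        LinearMap.mul K (UniversalEnvelopingAlgebra K g) x *
          LinearMap.mul K (UniversalEnvelopingAlgebra K g) y := fun x y =>
      LinearMap.ext fun z => mul_assoc x y z
    induction u using induction_left with
    | one =>
      rw [h.crossed_one _ (LinearMap.ext fun z => one_mul z), one_mul]
      rfl
    | add u w hu hw => simp only [add_mul, map_add, LinearMap.add_apply, hu, hw, crossed_add]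
    | smul r u hu =>
      simp only [smul_mul_assoc, map_smul, LinearMap.smul_apply, hu, crossed_smul]
    | mul X u hu =>
      rw [mul_assoc, coactU_ι_mul, coactStep_apply, hu, h.crossed_ι_mul _ hm,
        Module.End.mul_apply, LinearMap.add_apply]
      congr 1
      generalize h.crossed _ u (h.coactU v) = s
      generalize coact X = n
      induction s with
      | zero => simp
      | add s t hs ht => simp only [mul_add, map_add, hs, ht]
      | tmul a f =>
        induction n with
        | zero => simp
        | add s t hs ht => simp only [add_mul, map_add, LinearMap.add_apply, hs, ht]
        | tmul Y e =>
          rw [LinearMap.rTensor_tmul, Algebra.TensorProduct.tmul_mul_tmul]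
          rfl
  act_coact := h.act_coactU

end Coaction

end IsLieHopf

/-- The evaluation formula determines `act`, since a representative function is determined by its
values; uniqueness of the coaction thus refers to the intended action. The finite basis supplies the
finite-dimensionality of g₁ on which stability of R(g₂) rests. -/
theorem mainTheorem6 {g₁ g₂ : Type*} [LieRing g₁] [LieAlgebra ℂ g₁] [LieRing g₂]
    [LieAlgebra ℂ g₂] [FiniteDimensional ℂ g₂] (M : LieMatchedPair ℂ g₁ g₂)
    {κ : Type*} [Fintype κ] (b : Module.Basis κ ℂ g₁) :
    ∃ act : UniversalEnvelopingAlgebra ℂ g₁ →ₐ[ℂ] Module.End ℂ (RepresentativeFunctions ℂ g₂),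
      (∀ (u : UniversalEnvelopingAlgebra ℂ g₁) (f : RepresentativeFunctions ℂ g₂)
        (v : UniversalEnvelopingAlgebra ℂ g₂),
        FiniteDual.ev v (act u f) = FiniteDual.ev (M.rightAct v u) f) ∧
      IsLieHopf b (act.toLinearMap ∘ₗ UniversalEnvelopingAlgebra.ιLin ℂ g₁) (M.coaction b) ∧
      ∃! coact : UniversalEnvelopingAlgebra ℂ g₁ →ₗ[ℂ]
          UniversalEnvelopingAlgebra ℂ g₁ ⊗[ℂ] RepresentativeFunctions ℂ g₂,
        (∀ X : g₁, coact (UniversalEnvelopingAlgebra.ιLin ℂ g₁ X) =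
          (UniversalEnvelopingAlgebra.ιLin ℂ g₁).rTensor _ (M.coaction b X)) ∧
        IsHopfMatchedPair act coact := by
  have : FiniteDimensional ℂ g₁ := b.finiteDimensional_of_finite
  have h := M.isLieHopf b
  exact ⟨M.actRep, M.ev_actRep, h, h.coactU, ⟨h.coactU_ι, h.isHopfMatchedPair⟩,
    fun _ hc => h.coactU_unique hc.2 hc.1⟩
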